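/- Let $X\in\mathbb R^{d\times n}$ be a nonnegative matrix which is $k$-separable: there are an index set $I\subseteq\{1,\dots,n\}$ of size $k$ and a nonnegative matrix $H\in\mathbb R^{k\times n}$ with $X=X_IH$, where $X_I$ consists of the columns of $X$ indexed by $I$, and the columns $x_i$, $i\in I$, are precisely the extreme points (each listed once) of the convex polytope $P=\operatorname{conv}\{x_1,\dots,x_n\}$ spanned by the columns of $X$. For $i\in I$ let $\omega_i$ be the solid angle of the normal cone $N_P(x_i)=\{w\in\mathbb R^d: w^T(y-x_i)\le 0\text{ for all }y\in P\}$, that is, the probability that a uniformly random point of the unit sphere $S^{d-1}$ lies in $N_P(x_i)$, and let $$\kappa=\frac{1}{k\log\bigl(1/\max_{i\in I}(1-2\omega_i)\bigr)}$$ be the condition number (with $\kappa=0$ in the degenerate cases $k\le 2$, in which $\max_{i}(1-2\omega_i)\le 0$). For integers $m,B\ge 1$ let $T=GS$, where $G$ is an $m\times B$ matrix with i.i.d. $N(0,1)$ entries and $S$ is a $B\times d$ CountSketch matrix independent of $G$: every column of $S$ has exactly one nonzero entry, in a uniformly random position, with value $+1$ or $-1$ with probability $1/2$ each, all these choices being independent.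 The CountGauss NMF algorithm computes $Z=TX$ and outputs $I_{\max}\cup I_{\min}$, where $I_{\max}$ (resp. $I_{\min}$) is the set of all indices $j$ such that $Z_{rj}$ is the maximum (resp. minimum) of the $r$-th row of $Z$ for some $r\in\{1,\dots,m\}$. **Theorem.** There is an absolute constant $C>1$ such that for all $d,n,k$, every such $X$ and $I$, every $\delta>0$, and all integers $m\ge1$, $B\ge 1$ with $$m\ \ge\ \kappa\,k\,\log\frac{k}{\delta},\qquad B\ \ge\ \frac1\delta\,C\,(\log d)^4\,n^2\,m^{1/2}$$ (in particular when $m\geq 1$ is $\kappa k\log(k/\delta)$ rounded up), one has $$\Pr\bigl[\,I\subseteq I_{\max}\cup I_{\min}\,\bigr]\ \ge\ 1-2\delta .$$ -/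

import Mathlib

open MeasureTheory ProbabilityTheory
open scoped Matrix

noncomputable section

namespace CountGauss

/-- The sample space of the transform: the entries of an `m × B` matrix, together with, for each of
the `d` columns of a `B × d` CountSketch matrix, the position and the sign of its nonzero entry. -/
abbrev Sample (m B d : ℕ) : Type :=
  (Fin m → Fin B → ℝ) × (Fin d → Fin B × Bool)

/-- The law of the random choices: the Gaussian entries are i.i.d. `N(0,1)`, the positions are
uniform in `{1, …, B}`, the signs are uniform, and all of these choices are independent. -/
def sampleLaw (m B d : ℕ) : Measure (Sample m B d) :=
  (Measure.pi fun _ : Fin m => Measure.pi fun _ : Fin B => gaussianReal 0 1).prod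
    (Measure.pi fun _ : Fin d =>
      (uniformOn (Set.univ : Set (Fin B))).prod (uniformOn (Set.univ : Set Bool)))

instance (m B d : ℕ) [NeZero B] : IsProbabilityMeasure (sampleLaw m B d) := by
  unfold sampleLaw; infer_instance

/-- The Gaussian matrix `G`. -/
def gaussianMatrix {m B d : ℕ} (ω : Sample m B d) : Matrix (Fin m) (Fin B) ℝ :=
  Matrix.of ω.1

/-- The CountSketch matrix `S`: column `j` has a single nonzero entry, equal to `1` or `-1`. -/
def countSketchMatrix {m B d : ℕ} (ω : Sample m B d) : Matrix (Fin B) (Fin d) ℝ :=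
  Matrix.of fun b j => if (ω.2 j).1 = b then (if (ω.2 j).2 then 1 else -1) else 0

/-- The CountGauss transform `T = G S`. -/
def transform {m B d : ℕ} (ω : Sample m B d) : Matrix (Fin m) (Fin d) ℝ :=
  gaussianMatrix ω * countSketchMatrix ω

/-- The indices at which some row of `Z` attains its maximum. -/
def argmaxIndices {m n : ℕ} (Z : Matrix (Fin m) (Fin n) ℝ) : Set (Fin n) :=
  {j | ∃ r, ∀ l, Z r l ≤ Z r j}

/-- The indices at which some row of `Z` attains its minimum. -/
def argminIndices {m n : ℕ} (Z : Matrix (Fin m) (Fin n) ℝ) : Set (Fin n) :=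
  {j | ∃ r, ∀ l, Z r j ≤ Z r l}

/-- The output `I_max ∪ I_min` of the CountGauss NMF algorithm on `X`. -/
def algorithmOutput {m B d n : ℕ} (X : Matrix (Fin d) (Fin n) ℝ) (ω : Sample m B d) :
    Set (Fin n) :=
  argmaxIndices (transform ω * X) ∪ argminIndices (transform ω * X)

/-- Column `j` of `X` as a point of Euclidean space. -/
def column {d n : ℕ} (X : Matrix (Fin d) (Fin n) ℝ) (j : Fin n) : EuclideanSpace ℝ (Fin d) :=
  WithLp.toLp 2 fun i => X i j

/-- The convex polytope defined by the columns of `X`. -/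
def polytope {d n : ℕ} (X : Matrix (Fin d) (Fin n) ℝ) : Set (EuclideanSpace ℝ (Fin d)) :=
  convexHull ℝ (Set.range (column X))

/-- `X` is nonnegative and `k`-separable with respect to the index set `I`: the set `I` has size
`k` and `X = X_I H` for some nonnegative `H`. -/
def IsSeparable {d n : ℕ} (X : Matrix (Fin d) (Fin n) ℝ) (k : ℕ) (I : Finset (Fin n)) : Prop :=
  I.card = k ∧ (∀ i j, 0 ≤ X i j) ∧
    ∃ H : Matrix I (Fin n) ℝ, (∀ i j, 0 ≤ H i j) ∧
      X = X.submatrix id (Subtype.val : I → Fin n) * H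

/-- `I` is the index set of the extreme points of the polytope of the columns of `X`: the columns
indexed by `I` are exactly the extreme points, each listed once. -/
def IsExtremeIndexSet {d n : ℕ} (X : Matrix (Fin d) (Fin n) ℝ) (I : Finset (Fin n)) : Prop :=
  Set.BijOn (column X) I ((polytope X).extremePoints ℝ)

/-- The normal cone of `C` at `x`. -/
def normalCone {d : ℕ} (C : Set (EuclideanSpace ℝ (Fin d))) (x : EuclideanSpace ℝ (Fin d)) :
    Set (EuclideanSpace ℝ (Fin d)) :=
  {w | ∀ y ∈ C, inner ℝ w (y - x) ≤ 0}

/-- The solid angle of a cone `K`: the probability that a uniformly random point of the unit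
sphere lies in `K`. -/
def solidAngle {d : ℕ} (K : Set (EuclideanSpace ℝ (Fin d))) : ℝ :=
  (volume : Measure (EuclideanSpace ℝ (Fin d))).toSphere.real {θ | (θ : EuclideanSpace ℝ (Fin d)) ∈ K} /
    (volume : Measure (EuclideanSpace ℝ (Fin d))).toSphere.real Set.univ

/-- The condition number `κ = 1 / (k log (1 / max_{i ∈ I} (1 - 2 ω_i)))`, where `k = |I|` and `ω_i`
is the solid angle of the normal cone of the polytope at column `i`. For a polytope with at least
three extreme points one has `0 < 1 - 2 ω_i < 1`. With one or two extreme points the maximum is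
`-1` or `0`, and the value of this expression is then `0`. -/
def conditionNumber {d n : ℕ} (X : Matrix (Fin d) (Fin n) ℝ) (I : Finset (Fin n)) : ℝ :=
  1 / ((I.card : ℝ) *
    Real.log (1 / ⨆ i : I, (1 - 2 * solidAngle (normalCone (polytope X) (column X i)))))

end CountGauss

end

namespace CountGauss

open scoped ENNReal NNReal

/-! Let `w` be a standard Gaussian direction and let there be at least three vertices. Vertex `i` is
extremal for `w` with probability `q_i = 2ω_i`, since the Gaussian measure of a cone is its solid
angle and a cone and its negative weigh the same. If the rows were Gaussian on the original space,
all `m` of them would miss `i` with probability `(1 - q_i)^m`, and the lower bound on `m` makes this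
at most `δ/k`; a union bound over the vertices would finish.

With the sketch `S` fixed, the rows are still independent, and only the restriction of `S` to the
span of the columns matters, a space of dimension at most `n`. In an eigenbasis of the Gram operator
of this restriction, sketching multiplies the Gaussian coordinates by `√c_j`. By
`gaussian_scaling_ge` a set of measure `q` then keeps measure at least `q (1 - 8 D (1 + log
(1/q)))`, where `D` is the Frobenius distance of the Gram matrix to the identity
(`stdGaussian_map_ge`). By `sum_sketch_inner_sub_sq_le` the mean of `D²` is at most `2n²/B`.

The conditional failure probability is thus at most `1` and at most `δ e^y`, with `y` proportional
to `D`. Since only the second moment of `D` is controlled, `le_add_sq_of_le_mul_exp` replaces this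
by `3δ/2` plus a multiple of `y² / log² (1/δ)`, whose mean is at most `δ/2` for the given `B`. The
remaining logarithms are absorbed into `√m` by `log_factors_le`. With at most two vertices the
polytope is a segment or a point, and any single row succeeds. -/

/-! ### Gaussian product measures under diagonal scaling -/

theorem lintegral_pi_prod {ι : Type*} [Fintype ι] {E : ι → Type*} [∀ i, MeasurableSpace (E i)]
    (μ : (i : ι) → Measure (E i)) [∀ i, IsProbabilityMeasure (μ i)]
    (f : (i : ι) → E i → ℝ≥0∞) (hf : ∀ i, Measurable (f i)) :
    ∫⁻ x, ∏ i, f i (x i) ∂(Measure.pi μ) = ∏ i, ∫⁻ x, f i x ∂(μ i) := by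
  have h := lintegral_prod_eq_prod_lintegral_of_indepFun (μ := Measure.pi μ) Finset.univ
    (fun i x => f i (x i)) (iIndepFun_pi (X := f) fun i => (hf i).aemeasurable)
    (fun i => (hf i).comp (measurable_pi_apply i))
  rw [h]
  refine Finset.prod_congr rfl fun i _ => ?_
  rw [← (measurePreserving_eval μ i).lintegral_comp (hf i)]

theorem pi_withDensity {ι : Type*} [Fintype ι] {E : ι → Type*} [∀ i, MeasurableSpace (E i)]
    (μ : (i : ι) → Measure (E i)) [∀ i, IsProbabilityMeasure (μ i)]
    (f : (i : ι) → E i → ℝ≥0∞) (hf : ∀ i, Measurable (f i))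
    [∀ i, SigmaFinite ((μ i).withDensity (f i))] :
    Measure.pi (fun i => (μ i).withDensity (f i)) =
      (Measure.pi μ).withDensity (fun x => ∏ i, f i (x i)) := by
  refine Measure.pi_eq fun s hs => ?_
  rw [withDensity_apply _ (MeasurableSet.univ_pi hs),
    ← lintegral_indicator (MeasurableSet.univ_pi hs)]
  have : (Set.univ.pi s).indicator (fun x => ∏ i, f i (x i)) =
      fun x => ∏ i, (s i).indicator (f i) (x i) := by
    classical
    funext x
    by_cases hx : x ∈ Set.univ.pi s
    · rw [Set.indicator_of_mem hx]
      exact Finset.prod_congr rfl fun i _ => (Set.indicator_of_mem (hx i trivial) _).symm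
    · rw [Set.indicator_of_notMem hx]
      simp only [Set.mem_pi, Set.mem_univ, forall_const, not_forall] at hx
      obtain ⟨i, hi⟩ := hx
      exact (Finset.prod_eq_zero (Finset.mem_univ i) (Set.indicator_of_notMem hi _)).symm
  rw [this, lintegral_pi_prod μ _ fun i => (hf i).indicator (hs i)]
  refine Finset.prod_congr rfl fun i _ => ?_
  rw [lintegral_indicator (hs i), withDensity_apply _ (hs i)]

/-- The density of `N(0, v)` with respect to `N(0, 1)`. -/
noncomputable def gaussianRatio (v x : ℝ) : ℝ := (√v)⁻¹ * Real.exp (-(x ^ 2 / 2) * (v⁻¹ - 1))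

theorem gaussianRatio_pos {v : ℝ} (hv : 0 < v) (x : ℝ) : 0 < gaussianRatio v x := by
  unfold gaussianRatio; positivity

theorem measurable_gaussianRatio (v : ℝ) : Measurable (gaussianRatio v) := by
  unfold gaussianRatio; fun_prop

theorem gaussianReal_eq_withDensity {v : ℝ≥0} (hv : v ≠ 0) :
    gaussianReal 0 v =
      (gaussianReal 0 1).withDensity fun x => ENNReal.ofReal (gaussianRatio v x) := by
  have hv0 : (0 : ℝ) < v := by positivity
  rw [gaussianReal_of_var_ne_zero 0 hv, gaussianReal_of_var_ne_zero 0 one_ne_zero,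
    ← withDensity_mul₀ (measurable_gaussianPDF 0 1).aemeasurable
      (measurable_gaussianRatio v).ennreal_ofReal.aemeasurable]
  congr 1
  funext x
  rw [Pi.mul_apply, gaussianPDF, gaussianPDF, ← ENNReal.ofReal_mul (gaussianPDFReal_nonneg _ _ _)]
  congr 1
  rw [gaussianPDFReal, gaussianPDFReal, gaussianRatio, Real.sqrt_mul (by positivity)]
  have h2 : √(2 * Real.pi) ≠ 0 := by positivity
  have h3 : √(v : ℝ) ≠ 0 := by positivity
  rw [show (√(2 * Real.pi * ((1 : ℝ≥0) : ℝ)))⁻¹ * Real.exp (-(x - 0) ^ 2 / (2 * ((1 : ℝ≥0) : ℝ))) *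
      ((√(v : ℝ))⁻¹ * Real.exp (-(x ^ 2 / 2) * ((v : ℝ)⁻¹ - 1))) =
      (√(2 * Real.pi))⁻¹ * (√(v : ℝ))⁻¹ * (Real.exp (-(x - 0) ^ 2 / (2 * ((1 : ℝ≥0) : ℝ))) *
       Real.exp (-(x ^ 2 / 2) * ((v : ℝ)⁻¹ - 1))) by simp; ring, ← Real.exp_add, mul_inv]
  congr 2
  field_simp
  simp
  ring

theorem integral_exp_sq_gaussianReal {c : ℝ} (hc : 0 < 1 + c) :
    Integrable (fun x : ℝ => Real.exp (-(c * x ^ 2 / 2))) (gaussianReal 0 1) ∧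
    ∫ x, Real.exp (-(c * x ^ 2 / 2)) ∂(gaussianReal 0 1) = (√(1 + c))⁻¹ := by
  have hfun : ∀ x : ℝ, gaussianPDFReal 0 1 x • Real.exp (-(c * x ^ 2 / 2)) =
      (√(2 * Real.pi))⁻¹ * Real.exp (-((1 + c) / 2) * x ^ 2) := by
    intro x
    rw [gaussianPDFReal, smul_eq_mul, mul_assoc, ← Real.exp_add]
    congr 2
    · simp
    · simp; ring
  constructor
  · have h0 := (integrable_exp_neg_mul_sq (b := (1 + c) / 2) (by positivity)).const_mul
      (√(2 * Real.pi))⁻¹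
    simp_rw [← hfun] at h0
    rw [gaussianReal_of_var_ne_zero 0 one_ne_zero]
    rw [integrable_withDensity_iff_integrable_smul' (measurable_gaussianPDF 0 1)
      (ae_of_all _ fun x => gaussianPDF_lt_top)]
    simpa [toReal_gaussianPDF] using h0
  · rw [integral_gaussianReal_eq_integral_smul one_ne_zero]
    simp_rw [hfun]
    rw [integral_const_mul, integral_gaussian, ← Real.sqrt_inv, ← Real.sqrt_mul (by positivity),
      ← Real.sqrt_inv]
    congr 1
    field_simp

theorem gaussianRatio_rpow_neg {v : ℝ} (hv : 0 < v) (s x : ℝ) :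
    gaussianRatio v x ^ (-s) =
      Real.exp (s / 2 * Real.log v) * Real.exp (-((-s * (v⁻¹ - 1)) * x ^ 2 / 2)) := by
  rw [gaussianRatio, Real.mul_rpow (by positivity) (by positivity), ← Real.exp_mul,
    Real.sqrt_eq_rpow, ← Real.rpow_neg hv.le, ← Real.rpow_mul hv.le, Real.rpow_def_of_pos hv]
  congr 2 <;> ring

theorem neg_log_one_add_le {z : ℝ} (hz : |z| ≤ 1 / 4) :
    -Real.log (1 + z) ≤ -z + 2 * z ^ 2 := by
  obtain ⟨h1, h2⟩ := abs_le.1 hz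
  have hpos : 0 < 1 + z := by linarith
  have h := Real.one_sub_inv_le_log_of_pos hpos
  have : (1 + z)⁻¹ ≤ 1 - z + 2 * z ^ 2 := by
    rw [inv_le_iff_one_le_mul₀ hpos]
    nlinarith [sq_nonneg z, mul_nonneg (sq_nonneg z) (by linarith : 0 ≤ 1 / 4 + z)]
  linarith

/-- The moment is computed exactly, and its exponent has no term linear in `v - 1`: those of `log v`
and `log (1 + z)` cancel. Only second-order terms remain, so a product over coordinates is
controlled by the sum of the `(v i - 1) ^ 2`, with no factor for the dimension. -/
theorem integral_gaussianRatio_rpow_neg_le {v s : ℝ} (hs : 0 < s) (hv : |v - 1| ≤ 1 / 2)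
    (hsv : s * |v - 1| ≤ 1 / 8) :
    Integrable (fun x => gaussianRatio v x ^ (-s)) (gaussianReal 0 1) ∧
    ∫ x, gaussianRatio v x ^ (-s) ∂(gaussianReal 0 1) ≤
      Real.exp (s * (v - 1) ^ 2 + 4 * s ^ 2 * (v - 1) ^ 2) := by
  obtain ⟨h1, h2⟩ := abs_le.1 hv
  have hv0 : 0 < v := by linarith
  have hinv : v⁻¹ ≤ 2 := by
    rw [inv_le_comm₀ hv0 (by norm_num)]; linarith
  have hinv0 : 0 < v⁻¹ := by positivity
  set z := -s * (v⁻¹ - 1) with hz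
  have hz' : z = s * (v - 1) * v⁻¹ := by rw [hz]; field_simp; ring
  have hzabs : |z| ≤ 1 / 4 := by
    rw [hz', abs_mul, abs_mul, abs_of_pos hs, abs_of_pos hinv0]
    nlinarith [abs_nonneg (v - 1)]
  have hz1 : 0 < 1 + z := by linarith [(abs_le.1 hzabs).1]
  obtain ⟨hI, hE⟩ := integral_exp_sq_gaussianReal hz1
  simp_rw [gaussianRatio_rpow_neg hv0]
  refine ⟨hI.const_mul _, ?_⟩
  rw [integral_const_mul, hE]
  rw [show (√(1 + z))⁻¹ = Real.exp (-(Real.log (1 + z) / 2)) by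
    rw [← Real.log_sqrt hz1.le, Real.exp_neg, Real.exp_log (by positivity)], ← Real.exp_add]
  refine Real.exp_le_exp.2 ?_
  have hl := Real.log_le_sub_one_of_pos hv0
  have hl2 := neg_log_one_add_le hzabs
  have hz3 : z ^ 2 ≤ 4 * (s ^ 2 * (v - 1) ^ 2) := by
    rw [hz', mul_pow, mul_pow]
    have : v⁻¹ ^ 2 ≤ 4 := by nlinarith
    nlinarith [mul_nonneg (sq_nonneg s) (sq_nonneg (v - 1))]
  have h4 : s / 2 * (v - 1) - z / 2 ≤ s * (v - 1) ^ 2 := by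
    have : s * (v - 1) - z = s * (v - 1) ^ 2 * v⁻¹ := by rw [hz']; field_simp
    have h5 : s * (v - 1) ^ 2 * v⁻¹ ≤ s * (v - 1) ^ 2 * 2 := by gcongr
    linarith
  have h5 : s / 2 * Real.log v ≤ s / 2 * (v - 1) := by gcongr
  linarith

/-- Stability of the Gaussian measure of a set under a diagonal change of the covariance. -/
theorem gaussian_scaling_ge {ι : Type*} [Fintype ι] {K : Set (ι → ℝ)} (hK : MeasurableSet K)
    (v : ι → ℝ) :
    (Measure.pi fun _ : ι => gaussianReal 0 1).real K *
        (1 - 8 * √(∑ i, (v i - 1) ^ 2) *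
          (1 + Real.log (1 / (Measure.pi fun _ : ι => gaussianReal 0 1).real K))) ≤
      (Measure.pi fun _ : ι => gaussianReal 0 1).real {y | (fun i => √(v i) * y i) ∈ K} := by
  set γ := Measure.pi fun _ : ι => gaussianReal 0 1 with hγ
  set q := γ.real K with hq
  set D := √(∑ i, (v i - 1) ^ 2) with hD
  have hq0 : 0 ≤ q := measureReal_nonneg
  have hq1 : q ≤ 1 := measureReal_le_one
  rcases hq0.eq_or_lt with h0 | hqpos
  · rw [← h0]; simp
  set a := Real.log (1 / q) with ha
  have ha0 : 0 ≤ a := Real.log_nonneg (by rw [le_div_iff₀ hqpos]; linarith)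
  have hD0 : 0 ≤ D := Real.sqrt_nonneg _
  have hDsq : D ^ 2 = ∑ i, (v i - 1) ^ 2 := Real.sq_sqrt (Finset.sum_nonneg fun i _ => sq_nonneg _)
  -- For `D > 1/2` the left side is nonpositive. Otherwise every `v i` is at least `1/2`.
  by_cases hDbig : 1 / 2 < D
  · refine le_trans ?_ measureReal_nonneg
    refine mul_nonpos_of_nonneg_of_nonpos hq0 ?_
    nlinarith
  push Not at hDbig
  have hvD : ∀ i, |v i - 1| ≤ D := fun i => by
    rw [hD]
    refine Real.abs_le_sqrt ?_
    exact Finset.single_le_sum (f := fun i => (v i - 1) ^ 2) (fun i _ => sq_nonneg _)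
      (Finset.mem_univ i)
  have hvpos : ∀ i, 0 < v i := fun i => by
    have := (abs_le.1 (hvD i)).1; linarith
  -- `D = 0` is separated because the moment order below is `1 / (8 * D)`.
  rcases hD0.eq_or_lt with hDz | hDpos
  · have : ∀ i, v i = 1 := fun i => by
      have := hvD i
      rw [← hDz] at this
      have := abs_nonpos_iff.1 this
      linarith
    have h1 : ∀ y : ι → ℝ, (fun i => √(v i) * y i) = y := fun y => by funext i; simp [this]
    simp only [h1, ← hDz, Set.ofPred_mem_eq]
    simp [hq]
  -- the law of the scaled vector
  set f : (ι → ℝ) → ℝ := fun x => ∏ i, gaussianRatio (v i) (x i) with hf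
  have hfpos : ∀ x, 0 < f x := fun x => Finset.prod_pos fun i _ => gaussianRatio_pos (hvpos i) _
  have hfm : Measurable f := Finset.measurable_prod _ fun i _ =>
    (measurable_gaussianRatio (v i)).comp (measurable_pi_apply i)
  have hmapm : Measurable fun (y : ι → ℝ) (i : ι) => √(v i) * y i := by fun_prop
  have hlaw : γ.map (fun (y : ι → ℝ) (i : ι) => √(v i) * y i) =
      γ.withDensity fun x => ENNReal.ofReal (f x) := by
    have h1 : γ.map (fun (y : ι → ℝ) (i : ι) => √(v i) * y i) =
        Measure.pi fun i => (gaussianReal 0 1).map (fun x => √(v i) * x) := by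
      rw [hγ, Measure.pi_map_pi fun i => by fun_prop]
    have h2 : ∀ i, (gaussianReal 0 1).map (fun x => √(v i) * x) =
        (gaussianReal 0 1).withDensity fun x => ENNReal.ofReal (gaussianRatio (v i) x) := by
      intro i
      rw [gaussianReal_map_const_mul]
      have h3 := gaussianReal_eq_withDensity (v := (v i).toNNReal)
        (Real.toNNReal_pos.2 (hvpos i)).ne'
      rw [Real.coe_toNNReal _ (hvpos i).le] at h3
      rw [mul_zero, ← h3]
      congr 1
      ext
      rw [Real.coe_toNNReal _ (hvpos i).le]
      simp [Real.sq_sqrt (hvpos i).le]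
    rw [h1]
    have h3 : (fun x : ι → ℝ => ENNReal.ofReal (f x)) =
        fun x => ∏ i, ENNReal.ofReal (gaussianRatio (v i) (x i)) := by
      funext x
      exact ENNReal.ofReal_prod_of_nonneg fun i _ => (gaussianRatio_pos (hvpos i) _).le
    have h4 : ∀ i, SigmaFinite ((gaussianReal 0 1).withDensity
        fun x => ENNReal.ofReal (gaussianRatio (v i) x)) := fun i => by
      rw [← h2 i]; infer_instance
    rw [h3, ← pi_withDensity (fun _ => gaussianReal 0 1)
      (fun i x => ENNReal.ofReal (gaussianRatio (v i) x))
      fun i => (measurable_gaussianRatio (v i)).ennreal_ofReal]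
    simp_rw [h2]
  have hprob : ∫⁻ x, ENNReal.ofReal (f x) ∂γ = 1 := by
    have : (γ.map (fun (y : ι → ℝ) (i : ι) => √(v i) * y i)) Set.univ = 1 := by
      rw [Measure.map_apply hmapm .univ]; simp
    rw [hlaw, withDensity_apply _ .univ] at this
    simpa using this
  have hfint : Integrable f γ := by
    refine ⟨hfm.aestronglyMeasurable, ?_⟩
    rw [hasFiniteIntegral_iff_ofReal (ae_of_all _ fun x => (hfpos x).le), hprob]
    simp
  have hmeas : γ.real {y | (fun i => √(v i) * y i) ∈ K} = ∫ x in K, f x ∂γ := by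
    have : γ {y | (fun i => √(v i) * y i) ∈ K} =
        (γ.map (fun (y : ι → ℝ) (i : ι) => √(v i) * y i)) K := by
      rw [Measure.map_apply hmapm hK]; rfl
    rw [measureReal_def, this, hlaw, withDensity_apply _ hK,
      integral_eq_lintegral_of_nonneg_ae (ae_of_all _ fun x => (hfpos x).le)
        hfm.aestronglyMeasurable]
  -- negative moments of the density
  set s := 1 / (8 * D) with hs
  have hspos : 0 < s := by positivity
  have hsD : s * D = 1 / 8 := by rw [hs]; field_simp
  have hmom : ∀ i, Integrable (fun x => gaussianRatio (v i) x ^ (-s)) (gaussianReal 0 1) ∧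
      ∫ x, gaussianRatio (v i) x ^ (-s) ∂(gaussianReal 0 1) ≤
        Real.exp (s * (v i - 1) ^ 2 + 4 * s ^ 2 * (v i - 1) ^ 2) := fun i =>
    integral_gaussianRatio_rpow_neg_le hspos ((hvD i).trans hDbig)
      (by rw [← hsD]; gcongr; exact hvD i)
  have hfs : ∀ x, f x ^ (-s) = ∏ i, gaussianRatio (v i) (x i) ^ (-s) := fun x =>
    (Real.finsetProd_rpow _ _ (fun i _ => (gaussianRatio_pos (hvpos i) _).le) _).symm
  have hfsint : Integrable (fun x => f x ^ (-s)) γ := by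
    simp_rw [hfs]
    exact Integrable.fintype_prod (f := fun i x => gaussianRatio (v i) x ^ (-s))
      (fun i => (hmom i).1)
  -- The choice `s * D = 1/8` makes the exponent `D/8 + 1/16`, which is at most `1/8`: the order `s`
  -- is the largest, up to a constant, for which the moment stays bounded.
  have hfsle : ∫ x, f x ^ (-s) ∂γ ≤ 2 := by
    simp_rw [hfs]
    rw [hγ, integral_fintype_prod_eq_prod (f := fun i x => gaussianRatio (v i) x ^ (-s))]
    calc _ ≤ ∏ i, Real.exp (s * (v i - 1) ^ 2 + 4 * s ^ 2 * (v i - 1) ^ 2) :=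
          Finset.prod_le_prod (fun i _ => integral_nonneg fun x =>
            (Real.rpow_pos_of_pos (gaussianRatio_pos (hvpos i) _) _).le) fun i _ => (hmom i).2
      _ = Real.exp (s * D ^ 2 + 4 * (s * D) ^ 2) := by
          rw [← Real.exp_sum, Finset.sum_add_distrib, ← Finset.mul_sum, ← Finset.mul_sum, ← hDsq]
          ring_nf
      _ ≤ Real.exp (1 / 8) := by
          refine Real.exp_le_exp.2 ?_
          rw [hsD, sq, ← mul_assoc, hsD]
          linarith
      _ ≤ 2 := by
          rw [← Real.le_log_iff_exp_le (by norm_num)]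
          linarith [Real.log_two_gt_d9]
  -- the pointwise bound
  have hpt : ∀ x, 1 - s⁻¹ * (a - 1) - s⁻¹ * (q * f x ^ (-s)) ≤ f x := by
    intro x
    have hlog : Real.log (f x) ≤ f x - 1 := Real.log_le_sub_one_of_pos (hfpos x)
    have hq' : q = Real.exp (-a) := by
      rw [ha, one_div, Real.log_inv, neg_neg, Real.exp_log hqpos]
    have hexp : q * f x ^ (-s) = Real.exp (-s * Real.log (f x) - a) := by
      rw [Real.rpow_def_of_pos (hfpos x), hq', ← Real.exp_add]
      ring_nf
    -- The shift by `a = log (1/q)` matters: the integral of `f ^ (-s)` over `K` is bounded only by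
    -- `2`, and the weight `q = exp (-a)` turns this into a loss proportional to `q`. The price is
    -- the term `a` in the final bound.
    have h1 := Real.add_one_le_exp (-s * Real.log (f x) - a)
    rw [← hexp] at h1
    have h2 : s⁻¹ * (-s * Real.log (f x)) ≤ s⁻¹ * (a - 1 + q * f x ^ (-s)) :=
      mul_le_mul_of_nonneg_left (by linarith) (by positivity)
    have h3 : s⁻¹ * (-s * Real.log (f x)) = - Real.log (f x) := by field_simp
    rw [h3] at h2
    linarith
  rw [hmeas]
  have hlow : ∫ x in K, (1 - s⁻¹ * (a - 1) - s⁻¹ * (q * f x ^ (-s))) ∂γ ≤ ∫ x in K, f x ∂γ := by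
    refine integral_mono ?_ hfint.integrableOn hpt
    exact ((integrable_const _).sub ((hfsint.const_mul q).const_mul s⁻¹)).integrableOn
  refine le_trans ?_ hlow
  rw [integral_sub (integrable_const _) ((hfsint.const_mul q).const_mul s⁻¹).integrableOn,
    integral_const, integral_const_mul, integral_const_mul]
  have hset : ∫ x in K, f x ^ (-s) ∂γ ≤ 2 :=
    (setIntegral_le_integral hfsint (ae_of_all _ fun x =>
      (Real.rpow_pos_of_pos (hfpos x) _).le)).trans hfsle
  have hsinv : s⁻¹ = 8 * D := by rw [hs, one_div, inv_inv]
  rw [measureReal_restrict_apply_univ, ← hq, hsinv, smul_eq_mul]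
  have : 8 * D * (q * ∫ x in K, f x ^ (-s) ∂γ) ≤ 8 * D * (q * 2) := by gcongr
  linarith

/-! ### Diagonalising the Gram operator; Gaussian coordinates -/

/-- Basis independence of the Frobenius norm: Parseval in one basis, symmetry of `T`, then Parseval
in the other. It moves the error from the eigenbasis, which depends on the sketch, to a basis fixed
beforehand. -/
theorem sum_norm_sq_map_orthonormalBasis {ι V : Type*} [Fintype ι] [NormedAddCommGroup V]
    [InnerProductSpace ℝ V] [FiniteDimensional ℝ V] (T : V →ₗ[ℝ] V) (hT : T.IsSymmetric)
    (u v : OrthonormalBasis ι ℝ V) : ∑ j, ‖T (v j)‖ ^ 2 = ∑ j, ‖T (u j)‖ ^ 2 := by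
  calc ∑ j, ‖T (v j)‖ ^ 2 = ∑ j, ∑ l, (inner ℝ (u l) (T (v j))) ^ 2 :=
        Finset.sum_congr rfl fun j _ => (u.sum_sq_inner_right _).symm
    _ = ∑ l, ∑ j, (inner ℝ (v j) (T (u l))) ^ 2 := by
        rw [Finset.sum_comm]
        refine Finset.sum_congr rfl fun l _ => Finset.sum_congr rfl fun j _ => ?_
        rw [← hT, real_inner_comm]
    _ = ∑ j, ‖T (u j)‖ ^ 2 := Finset.sum_congr rfl fun l _ => v.sum_sq_inner_right _

/-- An orthonormal basis whose image under `R` is orthogonal, together with the squared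
Frobenius distance of the Gram matrix of `R` to the identity. -/
theorem exists_orthonormalBasis_map_orthogonal {V W : Type*} [NormedAddCommGroup V]
    [InnerProductSpace ℝ V] [FiniteDimensional ℝ V] [NormedAddCommGroup W]
    [InnerProductSpace ℝ W] [FiniteDimensional ℝ W] {r : ℕ} (u : OrthonormalBasis (Fin r) ℝ V)
    (R : V →ₗ[ℝ] W) :
    ∃ (v : OrthonormalBasis (Fin r) ℝ V) (c : Fin r → ℝ),
      (∀ j l, inner ℝ (R (v j)) (R (v l)) = if j = l then c j else 0) ∧
      ∑ j, (c j - 1) ^ 2 =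
        ∑ j, ∑ l, (inner ℝ (R (u j)) (R (u l)) - inner ℝ (u j) (u l)) ^ 2 := by
  have hn : Module.finrank ℝ V = r := by simpa using Module.finrank_eq_card_basis u.toBasis
  -- Eigenvectors of `R†R` have pairwise orthogonal images, of squared norms the eigenvalues.
  set T := LinearMap.adjoint R ∘ₗ R with hTdef
  have hT : T.IsSymmetric := LinearMap.isSymmetric_adjoint_comp_self R
  have hTR : ∀ x y, inner ℝ x (T y) = inner ℝ (R x) (R y) := fun x y => by
    simp [hTdef, LinearMap.adjoint_inner_right]
  have hT1 : (T - 1).IsSymmetric := hT.sub LinearMap.IsSymmetric.id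
  set v := hT.eigenvectorBasis hn with hv
  refine ⟨v, hT.eigenvalues hn, fun j l => ?_, ?_⟩
  · rw [← hTR, hT.apply_eigenvectorBasis hn, inner_smul_right, orthonormal_iff_ite.1 v.orthonormal]
    split_ifs with h <;> simp [h]
  · have h1 : ∀ j, ‖(T - 1) (v j)‖ ^ 2 = (hT.eigenvalues hn j - 1) ^ 2 := fun j => by
      rw [LinearMap.sub_apply, hT.apply_eigenvectorBasis hn, Module.End.one_apply]
      have : ((hT.eigenvalues hn j : ℝ) • v j - v j) = (hT.eigenvalues hn j - 1) • v j := by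
        rw [sub_smul, one_smul]
      simp only [RCLike.ofReal_real_eq_id, id_eq]
      rw [this, norm_smul, v.norm_eq_one, mul_one, Real.norm_eq_abs, sq_abs]
    simp_rw [← h1]
    rw [sum_norm_sq_map_orthonormalBasis _ hT1 u v, Finset.sum_comm]
    refine Finset.sum_congr rfl fun j _ => ?_
    rw [← u.sum_sq_inner_right]
    refine Finset.sum_congr rfl fun l _ => ?_
    rw [LinearMap.sub_apply, inner_sub_right, hTR, Module.End.one_apply]

/-- The coordinates of a standard Gaussian vector along an orthonormal family are independent
standard Gaussian variables. -/
theorem map_inner_orthonormal_pi_gaussianReal {ι κ : Type*} [Fintype ι] [Fintype κ]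
    {f : ι → EuclideanSpace ℝ κ} (hf : Orthonormal ℝ f) :
    (Measure.pi fun _ : κ => gaussianReal 0 1).map
      (fun g i => inner ℝ (f i) (WithLp.toLp 2 g)) = Measure.pi fun _ : ι => gaussianReal 0 1 := by
  have hm : Measurable fun (g : κ → ℝ) (i : ι) => inner ℝ (f i) (WithLp.toLp 2 g) := by fun_prop
  have key : ((Measure.pi fun _ : κ => gaussianReal 0 1).map
      (fun g i => inner ℝ (f i) (WithLp.toLp 2 g))).map (WithLp.toLp 2) =
      (Measure.pi fun _ : ι => gaussianReal 0 1).map (WithLp.toLp 2) := by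
    rw [map_pi_eq_stdGaussian, Measure.map_map (by fun_prop) hm]
    have : (WithLp.toLp 2 ∘ fun (g : κ → ℝ) (i : ι) => inner ℝ (f i) (WithLp.toLp 2 g)) =
        (fun w : EuclideanSpace ℝ κ => (WithLp.toLp 2 fun i => inner ℝ (f i) w :
          EuclideanSpace ℝ ι)) ∘ WithLp.toLp 2 := rfl
    rw [this, ← Measure.map_map (by fun_prop) (by fun_prop), map_pi_eq_stdGaussian]
    have hP : IsProbabilityMeasure ((stdGaussian (EuclideanSpace ℝ κ)).map
        fun w => (WithLp.toLp 2 fun i => inner ℝ (f i) w : EuclideanSpace ℝ ι)) :=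
      Measure.isProbabilityMeasure_map (by fun_prop)
    refine Measure.ext_of_charFun ?_
    funext t
    rw [charFun_stdGaussian, charFun_apply, integral_map (by fun_prop) (by fun_prop)]
    have h1 : ∀ w : EuclideanSpace ℝ κ,
        inner ℝ (WithLp.toLp 2 fun i => inner ℝ (f i) w : EuclideanSpace ℝ ι) t =
          inner ℝ w (∑ i, t i • f i) := fun w => by
      rw [inner_sum, PiLp.inner_apply]
      refine Finset.sum_congr rfl fun i _ => ?_
      rw [inner_smul_right, real_inner_comm (f i) w]
      rfl
    simp_rw [h1]
    rw [← charFun_apply, charFun_stdGaussian]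
    congr 4
    have h2 : ‖∑ i, t i • f i‖ ^ 2 = ‖(t : EuclideanSpace ℝ ι)‖ ^ 2 := by
      rw [← real_inner_self_eq_norm_sq, hf.inner_sum, EuclideanSpace.real_norm_sq_eq]
      exact Finset.sum_congr rfl fun i _ => (sq _).symm
    exact congrArg _ ((pow_left_inj₀ (norm_nonneg _) (norm_nonneg _) two_ne_zero).1 h2)
  have h2 := congrArg (Measure.map (WithLp.ofLp (p := 2) (V := ι → ℝ))) key
  rw [Measure.map_map (by fun_prop) (by fun_prop), Measure.map_map (by fun_prop) (by fun_prop),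
    Measure.map_map (by fun_prop) (by fun_prop)] at h2
  exact h2.trans Measure.map_id

/-! ### Second moments of CountSketch -/

/-- The product of the CountSketch matrix given by positions and signs `s` with the vector `x`. -/
def sketch {B d : ℕ} (s : Fin d → Fin B × Bool) (x : Fin d → ℝ) (b : Fin B) : ℝ :=
  ∑ j, (if (s j).1 = b then (if (s j).2 then 1 else -1) else 0) * x j

theorem sum_fin_succ_fun {α : Type*} [Fintype α] {d : ℕ} (F : (Fin (d + 1) → α) → ℝ) :
    ∑ s, F s = ∑ s : Fin d → α, ∑ p : α, F (Fin.cons p s) := by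
  rw [← (Fin.consEquiv fun _ : Fin (d + 1) => α).sum_comp, Fintype.sum_prod_type, Finset.sum_comm]
  rfl

theorem sketch_cons {B d : ℕ} (p : Fin B × Bool) (s : Fin d → Fin B × Bool) (x : Fin (d + 1) → ℝ)
    (b : Fin B) : sketch (Fin.cons p s) x b =
      (if p.1 = b then (if p.2 then 1 else -1) else 0) * x 0 + sketch s (fun j => x j.succ) b := by
  simp [sketch, Fin.sum_univ_succ]

/-- Recursion behind both moment computations. The middle term is odd in the new sign, so it
vanishes on average; being linear in the old sketch, its square is again a sketched norm. -/
theorem sum_sketch_cons_mul {B d : ℕ} (p : Fin B × Bool) (s : Fin d → Fin B × Bool)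
    (x y : Fin (d + 1) → ℝ) :
    ∑ b, sketch (Fin.cons p s) x b * sketch (Fin.cons p s) y b =
      x 0 * y 0 + (if p.2 then 1 else -1) *
        sketch s (fun j => x 0 * y j.succ + y 0 * x j.succ) p.1 +
      ∑ b, sketch s (fun j => x j.succ) b * sketch s (fun j => y j.succ) b := by
  have h : ∀ b, sketch (Fin.cons p s) x b * sketch (Fin.cons p s) y b =
      (if p.1 = b then x 0 * y 0 + (if p.2 then 1 else -1) *
        sketch s (fun j => x 0 * y j.succ + y 0 * x j.succ) b else 0) +
      sketch s (fun j => x j.succ) b * sketch s (fun j => y j.succ) b := by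
    intro b
    have hlin : sketch s (fun j => x 0 * y j.succ + y 0 * x j.succ) b =
        x 0 * sketch s (fun j => y j.succ) b + y 0 * sketch s (fun j => x j.succ) b := by
      simp only [sketch, Finset.mul_sum, ← Finset.sum_add_distrib]
      exact Finset.sum_congr rfl fun j _ => by ring
    rw [sketch_cons, sketch_cons, hlin]
    split_ifs <;> ring
  simp_rw [h]
  rw [Finset.sum_add_distrib]
  simp

/-- The sketch preserves squared norms on average. -/
theorem sum_sketch_sq {B d : ℕ} (x : Fin d → ℝ) :
    ∑ s : Fin d → Fin B × Bool, ∑ b, sketch s x b ^ 2 =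
      (2 * B : ℝ) ^ d * ∑ j, x j ^ 2 := by
  induction d with
  | zero => simp [sketch]
  | succ d ih =>
    rw [sum_fin_succ_fun]
    have h : ∀ s : Fin d → Fin B × Bool, ∑ p : Fin B × Bool, ∑ b, sketch (Fin.cons p s) x b ^ 2 =
        2 * B * x 0 ^ 2 + 2 * B * ∑ b, sketch s (fun j => x j.succ) b ^ 2 := by
      intro s
      simp_rw [sq, sum_sketch_cons_mul]
      simp only [Fintype.sum_prod_type, Fintype.sum_bool, Finset.sum_add_distrib]
      simp
      ring
    simp_rw [h]
    rw [Finset.sum_add_distrib, ← Finset.mul_sum, ← Finset.mul_sum, ih, Fin.sum_univ_succ]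
    simp
    ring

/-- The second moment of the error of the sketch on inner products. -/
theorem sum_sketch_inner_sub_sq_le {B d : ℕ} (hB : 1 ≤ B) (x y : Fin d → ℝ) :
    ∑ s : Fin d → Fin B × Bool, (∑ b, sketch s x b * sketch s y b - ∑ j, x j * y j) ^ 2 ≤
      (2 * B : ℝ) ^ d * (2 / B * (∑ j, x j ^ 2) * ∑ j, y j ^ 2) := by
  have hB0 : (0 : ℝ) < B := by exact_mod_cast hB
  induction d with
  | zero => simp [sketch]
  | succ d ih =>
    rw [sum_fin_succ_fun]
    set x' : Fin d → ℝ := fun j => x j.succ with hx'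
    set y' : Fin d → ℝ := fun j => y j.succ with hy'
    set z : Fin d → ℝ := fun j => x 0 * y j.succ + y 0 * x j.succ with hz
    -- The term `x 0 * y 0` is reproduced exactly and cancels. Summing over the sign removes the
    -- cross term, and summing its square over the buckets gives the squared norm of the sketch of
    -- `z`.
    have h : ∀ s : Fin d → Fin B × Bool, ∑ p : Fin B × Bool,
        (∑ b, sketch (Fin.cons p s) x b * sketch (Fin.cons p s) y b - ∑ j, x j * y j) ^ 2 =
        2 * B * (∑ b, sketch s x' b * sketch s y' b - ∑ j, x' j * y' j) ^ 2 +
          2 * ∑ b, sketch s z b ^ 2 := by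
      intro s
      simp_rw [sum_sketch_cons_mul, Fin.sum_univ_succ (fun j => x j * y j)]
      rw [Fintype.sum_prod_type]
      have : ∀ b : Fin B, ∑ e : Bool, (x 0 * y 0 + (if e then 1 else -1) * sketch s z b +
          ∑ b, sketch s x' b * sketch s y' b - (x 0 * y 0 + ∑ j, x' j * y' j)) ^ 2 =
          2 * (∑ b, sketch s x' b * sketch s y' b - ∑ j, x' j * y' j) ^ 2 +
            2 * sketch s z b ^ 2 := by
        intro b
        rw [Fintype.sum_bool]
        simp only [if_true, Bool.false_eq_true, if_false]
        ring
      rw [Finset.sum_congr rfl fun b _ => this b, Finset.sum_add_distrib, ← Finset.mul_sum,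
        ← Finset.mul_sum]
      simp
      ring
    simp_rw [h]
    rw [Finset.sum_add_distrib, ← Finset.mul_sum, ← Finset.mul_sum, sum_sketch_sq]
    have hzle : ∑ j, z j ^ 2 ≤ 2 * (x 0 ^ 2 * ∑ j, y' j ^ 2 + y 0 ^ 2 * ∑ j, x' j ^ 2) := by
      rw [Finset.mul_sum, Finset.mul_sum, ← Finset.sum_add_distrib, Finset.mul_sum]
      refine Finset.sum_le_sum fun j _ => ?_
      simp only [hz, hx', hy']
      nlinarith [sq_nonneg (x 0 * y j.succ - y 0 * x j.succ)]
    rw [Fin.sum_univ_succ (fun j => x j ^ 2), Fin.sum_univ_succ (fun j => y j ^ 2)]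
    have hih := ih x' y'
    have hpow : (0 : ℝ) < (2 * B : ℝ) ^ d := by positivity
    calc _ ≤ 2 * B * ((2 * B : ℝ) ^ d * (2 / B * (∑ j, x' j ^ 2) * ∑ j, y' j ^ 2)) +
          2 * ((2 * B : ℝ) ^ d *
            (2 * (x 0 ^ 2 * ∑ j, y' j ^ 2 + y 0 ^ 2 * ∑ j, x' j ^ 2))) := by gcongr
      _ = (2 * B : ℝ) ^ (d + 1) * (2 / B * ((∑ j, x' j ^ 2) * (∑ j, y' j ^ 2) +
            (x 0 ^ 2 * ∑ j, y' j ^ 2 + y 0 ^ 2 * ∑ j, x' j ^ 2))) := by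
          field_simp
          ring
      _ ≤ _ := by
          refine mul_le_mul_of_nonneg_left ?_ (by positivity)
          rw [mul_assoc]
          refine mul_le_mul_of_nonneg_left ?_ (by positivity)
          have : 0 ≤ x 0 ^ 2 * y 0 ^ 2 := by positivity
          change _ ≤ (x 0 ^ 2 + ∑ j, x' j ^ 2) * (y 0 ^ 2 + ∑ j, y' j ^ 2)
          linarith

/-- The law of the positions and signs of the CountSketch matrix has mass `(2B)⁻ᵈ` at each point. -/
theorem sketchLaw_singleton {B d : ℕ} [NeZero B] (s : Fin d → Fin B × Bool) :
    (Measure.pi fun _ : Fin d => (uniformOn (Set.univ : Set (Fin B))).prod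
      (uniformOn (Set.univ : Set Bool))).real {s} = ((2 * B : ℝ) ^ d)⁻¹ := by
  rw [measureReal_def, Measure.pi_singleton]
  have : ∀ i, ((uniformOn (Set.univ : Set (Fin B))).prod (uniformOn (Set.univ : Set Bool))) {s i} =
      ((B : ENNReal))⁻¹ * (2 : ENNReal)⁻¹ := fun i => by
    rw [show ({s i} : Set (Fin B × Bool)) = {(s i).1} ×ˢ {(s i).2} by simp, Measure.prod_prod]
    rw [uniformOn_univ, uniformOn_univ]
    simp
  simp_rw [this]
  simp [ENNReal.toReal_mul, ENNReal.toReal_inv, mul_pow, mul_comm]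

/-! ### Solid angles as Gaussian measures -/

theorem pi_gaussianReal_eq_withDensity {ι : Type*} [Fintype ι] :
    (Measure.pi fun _ : ι => gaussianReal 0 1) =
      (volume : Measure (ι → ℝ)).withDensity
        fun x => ENNReal.ofReal (∏ i, gaussianPDFReal 0 1 (x i)) := by
  refine Measure.pi_eq fun s hs => ?_
  have hnn : ∀ i (x : ℝ), 0 ≤ (s i).indicator (gaussianPDFReal 0 1) x := fun i x =>
    Set.indicator_nonneg (fun y _ => gaussianPDFReal_nonneg 0 1 y) x
  have hint : ∀ i, Integrable ((s i).indicator (gaussianPDFReal 0 1)) := fun i =>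
    (integrable_gaussianPDFReal 0 1).indicator (hs i)
  have hind : (Set.univ.pi s).indicator
      (fun x => ENNReal.ofReal (∏ i, gaussianPDFReal 0 1 (x i))) =
      fun x => ENNReal.ofReal (∏ i, (s i).indicator (gaussianPDFReal 0 1) (x i)) := by
    classical
    funext x
    by_cases hx : x ∈ Set.univ.pi s
    · rw [Set.indicator_of_mem hx]
      congr 1
      exact Finset.prod_congr rfl fun i _ => (Set.indicator_of_mem (hx i trivial) _).symm
    · rw [Set.indicator_of_notMem hx]
      simp only [Set.mem_pi, Set.mem_univ, forall_const, not_forall] at hx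
      obtain ⟨i, hi⟩ := hx
      rw [Finset.prod_eq_zero (Finset.mem_univ i) (Set.indicator_of_notMem hi _),
        ENNReal.ofReal_zero]
  have hprod : Integrable
      (fun x : ι → ℝ => ∏ i, (s i).indicator (gaussianPDFReal 0 1) (x i)) :=
    Integrable.fintype_prod (f := fun i => (s i).indicator (gaussianPDFReal 0 1)) hint
  rw [withDensity_apply _ (MeasurableSet.univ_pi hs),
    ← lintegral_indicator (MeasurableSet.univ_pi hs), hind,
    ← ofReal_integral_eq_lintegral_ofReal hprod
      (ae_of_all _ fun x => Finset.prod_nonneg fun i _ => hnn i _),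
    integral_fintype_prod_volume_eq_prod
      (f := fun i => (s i).indicator (gaussianPDFReal 0 1)),
    ENNReal.ofReal_prod_of_nonneg fun i _ => integral_nonneg (hnn i)]
  refine Finset.prod_congr rfl fun i _ => ?_
  rw [gaussianReal_apply_eq_integral 0 one_ne_zero, integral_indicator (hs i)]

/-- The standard Gaussian measure of a set as an integral in Euclidean space. -/
theorem stdGaussian_apply {d : ℕ} {K : Set (EuclideanSpace ℝ (Fin d))}
    (hK : MeasurableSet K) :
    stdGaussian (EuclideanSpace ℝ (Fin d)) K =
      ∫⁻ w in K, ENNReal.ofReal ((√(2 * Real.pi))⁻¹ ^ d * Real.exp (-‖w‖ ^ 2 / 2)) := by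
  have hm : MeasurableSet {x : Fin d → ℝ | WithLp.toLp 2 x ∈ K} :=
    (show Measurable (WithLp.toLp 2 : (Fin d → ℝ) → EuclideanSpace ℝ (Fin d)) by fun_prop) hK
  rw [← map_pi_eq_stdGaussian, Measure.map_apply (by fun_prop) hK]
  change (Measure.pi fun _ : Fin d => gaussianReal 0 1) {x | WithLp.toLp 2 x ∈ K} = _
  rw [pi_gaussianReal_eq_withDensity, withDensity_apply _ hm]
  rw [← (EuclideanSpace.volume_preserving_symm_measurableEquiv_toLp
    (Fin d)).symm.setLIntegral_comp_preimage_emb (MeasurableEquiv.measurableEmbedding _)]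
  refine setLIntegral_congr_fun hm fun x _ => ?_
  congr 1
  simp only [gaussianPDFReal, Finset.prod_mul_distrib, Finset.prod_const, Finset.card_univ,
    Fintype.card_fin, ← Real.exp_sum]
  rw [EuclideanSpace.real_norm_sq_eq]
  simp [Finset.sum_div, neg_div]

/-- The standard Gaussian measure of a cone is its solid angle. -/
theorem solidAngle_eq_stdGaussian {d : ℕ} (hd : d ≠ 0) {K : Set (EuclideanSpace ℝ (Fin d))}
    (hK : MeasurableSet K) (hcone : ∀ c : ℝ, 0 < c → ∀ w, c • w ∈ K ↔ w ∈ K) :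
    solidAngle K =
      (stdGaussian (EuclideanSpace ℝ (Fin d))).real K := by
  have : NeZero d := ⟨hd⟩
  set φ : ℝ → ℝ≥0∞ := fun ρ => ENNReal.ofReal ((√(2 * Real.pi))⁻¹ ^ d * Real.exp (-ρ ^ 2 / 2))
    with hφ
  have hφm : Measurable φ := by
    rw [hφ]; fun_prop
  set σ := (volume : Measure (EuclideanSpace ℝ (Fin d))).toSphere
  set ν := Measure.volumeIoiPow (Module.finrank ℝ (EuclideanSpace ℝ (Fin d)) - 1)
  -- In polar coordinates the measure of any cone is its spherical measure times one radial
  -- integral. Taking the whole space as the cone identifies that integral, so it cancels in the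
  -- ratio.
  have polar : ∀ L : Set (EuclideanSpace ℝ (Fin d)), MeasurableSet L →
      (∀ c : ℝ, 0 < c → ∀ w, c • w ∈ L ↔ w ∈ L) →
      stdGaussian (EuclideanSpace ℝ (Fin d)) L =
        σ {θ | (θ : EuclideanSpace ℝ (Fin d)) ∈ L} * ∫⁻ ρ, φ ρ ∂ν := by
    intro L hL hc
    rw [stdGaussian_apply hL, ← lintegral_indicator hL]
    have h0 : ∫⁻ w : (EuclideanSpace ℝ (Fin d)), L.indicator (fun w => φ ‖w‖) w =
        ∫⁻ w in ({0}ᶜ : Set (EuclideanSpace ℝ (Fin d))), L.indicator (fun w => φ ‖w‖) w := by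
      rw [Measure.restrict_eq_self_of_ae_mem (s := {0}ᶜ)
        (compl_mem_ae_iff.2 (measure_singleton 0))]
    change ∫⁻ w : (EuclideanSpace ℝ (Fin d)), L.indicator (fun w => φ ‖w‖) w = _
    rw [h0,
      ← lintegral_subtype_comap (measurableSet_singleton (0 : EuclideanSpace ℝ (Fin d))).compl]
    have hmp :=
      (volume : Measure (EuclideanSpace ℝ (Fin d))).measurePreserving_homeomorphUnitSphereProd
    have h1 : ∀ w : ({0}ᶜ : Set (EuclideanSpace ℝ (Fin d))),
        L.indicator (fun w => φ ‖w‖) (w : EuclideanSpace ℝ (Fin d)) =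
        (fun p : Metric.sphere (0 : EuclideanSpace ℝ (Fin d)) 1 × Set.Ioi (0 : ℝ) =>
          ({θ : Metric.sphere (0 : EuclideanSpace ℝ (Fin d)) 1 |
            (θ : EuclideanSpace ℝ (Fin d)) ∈ L}.indicator 1 p.1) * φ p.2)
          (homeomorphUnitSphereProd (EuclideanSpace ℝ (Fin d)) w) := by
      intro w
      have hw : 0 < ‖(w : EuclideanSpace ℝ (Fin d))‖ := norm_pos_iff.2 w.2
      have hiff := hc (‖(w : EuclideanSpace ℝ (Fin d))‖⁻¹) (by positivity) w
      simp only [homeomorphUnitSphereProd_apply_snd_coe]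
      by_cases hwL : (w : EuclideanSpace ℝ (Fin d)) ∈ L
      · rw [Set.indicator_of_mem hwL,
          Set.indicator_of_mem (by simpa using hiff.2 hwL)]
        simp
      · rw [Set.indicator_of_notMem hwL,
          Set.indicator_of_notMem (by simpa using fun h => hwL (hiff.1 h))]
        simp
    have hS : MeasurableSet {θ : Metric.sphere (0 : EuclideanSpace ℝ (Fin d)) 1 |
        (θ : EuclideanSpace ℝ (Fin d)) ∈ L} :=
      measurable_subtype_coe hL
    simp_rw [h1]
    have hFm : Measurable fun p : Metric.sphere (0 : EuclideanSpace ℝ (Fin d)) 1 ×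
        Set.Ioi (0 : ℝ) => ({θ : Metric.sphere (0 : EuclideanSpace ℝ (Fin d)) 1 |
          (θ : EuclideanSpace ℝ (Fin d)) ∈ L}.indicator
            (1 : Metric.sphere (0 : EuclideanSpace ℝ (Fin d)) 1 → ℝ≥0∞) p.1) * φ p.2 :=
      ((measurable_one.indicator hS).comp measurable_fst).mul
        (hφm.comp (measurable_subtype_coe.comp measurable_snd))
    rw [hmp.lintegral_comp hFm,
      lintegral_prod_mul (g := fun ρ : Set.Ioi (0 : ℝ) => φ ρ)
        (measurable_one.indicator hS).aemeasurable
        (hφm.comp measurable_subtype_coe).aemeasurable, lintegral_indicator_one hS]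
  have hu := polar Set.univ .univ (by simp)
  have hKp := polar K hK hcone
  simp only [Set.mem_univ, Set.ofPred_true, measure_univ] at hu
  rw [measureReal_def, hKp, solidAngle, ENNReal.toReal_mul, measureReal_def, measureReal_def]
  have hu' := congrArg ENNReal.toReal hu
  rw [ENNReal.toReal_mul, ENNReal.toReal_one] at hu'
  rw [eq_one_div_of_mul_eq_one_right hu'.symm]
  field_simp
  rfl

/-! ### Gaussian measure under an almost isometric map -/

/-- If the linear map `R` is almost an isometry on `V`, then the Gaussian measure of a set defined
through inner products with vectors of `V` is almost preserved when these are mapped by `R`. -/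
theorem stdGaussian_map_ge {ι κ J : Type*} [Fintype ι] [Fintype κ]
    {V : Submodule ℝ (EuclideanSpace ℝ ι)} {r : ℕ} (u : OrthonormalBasis (Fin r) ℝ V)
    (R : V →ₗ[ℝ] EuclideanSpace ℝ κ) (z : J → V) {C : Set (J → ℝ)} (hC : MeasurableSet C) :
    (stdGaussian (EuclideanSpace ℝ ι)).real
        {w | (fun j => inner ℝ w (z j : EuclideanSpace ℝ ι)) ∈ C} *
        (1 - 8 * √(∑ j, ∑ l, (inner ℝ (R (u j)) (R (u l)) - inner ℝ (u j) (u l)) ^ 2) *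
          (1 + Real.log (1 / (stdGaussian (EuclideanSpace ℝ ι)).real
            {w | (fun j => inner ℝ w (z j : EuclideanSpace ℝ ι)) ∈ C}))) ≤
      (stdGaussian (EuclideanSpace ℝ κ)).real {g | (fun j => inner ℝ g (R (z j))) ∈ C} := by
  obtain ⟨v, c, hvc, hD⟩ := exists_orthonormalBasis_map_orthogonal u R
  rw [← hD]
  set D := √(∑ i, (c i - 1) ^ 2) with hDdef
  -- On both sides membership depends on `r` independent Gaussian coordinates `y`: as `L y` before
  -- applying `R`, and as `L` of the coordinates rescaled by `√(c l)` after it.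
  set L : (Fin r → ℝ) → J → ℝ := fun y j => ∑ l, inner ℝ (v l) (z j) * y l with hL
  have hLm : Measurable L := by rw [hL]; fun_prop
  set K : Set (Fin r → ℝ) := L ⁻¹' C with hK
  have hKm : MeasurableSet K := hLm hC
  have hz : ∀ j, z j = ∑ l, inner ℝ (v l) (z j) • v l := fun j => (v.sum_repr' (z j)).symm
  -- the measure of the original set
  have hq : (stdGaussian (EuclideanSpace ℝ ι)).real
      {w | (fun j => inner ℝ w (z j : EuclideanSpace ℝ ι)) ∈ C} =
      (Measure.pi fun _ : Fin r => gaussianReal 0 1).real K := by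
    have hv : Orthonormal ℝ (fun l => (v l : EuclideanSpace ℝ ι)) :=
      v.orthonormal.comp_linearIsometry V.subtypeₗᵢ
    have hm : MeasurableSet
        {w : EuclideanSpace ℝ ι | (fun j => inner ℝ w (z j : EuclideanSpace ℝ ι)) ∈ C} :=
      (show Measurable fun w : EuclideanSpace ℝ ι =>
        fun j => inner ℝ w (z j : EuclideanSpace ℝ ι) by fun_prop) hC
    rw [measureReal_def, measureReal_def, ← map_inner_orthonormal_pi_gaussianReal hv,
      Measure.map_apply (by fun_prop) hKm, ← map_pi_eq_stdGaussian,
      Measure.map_apply (by fun_prop) hm]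
    congr 2
    ext g
    simp only [Set.mem_preimage, hK, hL]
    change _ ∈ C ↔ _ ∈ C
    congr! 1
    funext j
    conv_lhs => rw [hz j]
    push_cast
    rw [inner_sum]
    refine Finset.sum_congr rfl fun l _ => ?_
    rw [inner_smul_right, real_inner_comm (WithLp.toLp 2 g)]
  rw [hq]
  by_cases hDbig : 1 / 2 < D
  · refine le_trans ?_ measureReal_nonneg
    refine mul_nonpos_of_nonneg_of_nonpos measureReal_nonneg ?_
    have : 0 ≤ Real.log (1 / (Measure.pi fun _ : Fin r => gaussianReal 0 1).real K) := by
      rw [one_div, Real.log_inv, neg_nonneg]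
      exact Real.log_nonpos measureReal_nonneg measureReal_le_one
    nlinarith
  push Not at hDbig
  have hcpos : ∀ i, 0 < c i := fun i => by
    have h1 : |c i - 1| ≤ D := Real.abs_le_sqrt
      (Finset.single_le_sum (f := fun i => (c i - 1) ^ 2) (fun i _ => sq_nonneg _)
        (Finset.mem_univ i))
    have := (abs_le.1 h1).1
    linarith
  refine (gaussian_scaling_ge hKm c).trans_eq ?_
  -- The normalised images of the eigenvectors; `D ≤ 1/2` keeps every `c l` positive.
  set f : Fin r → EuclideanSpace ℝ κ := fun l => (√(c l))⁻¹ • R (v l) with hf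
  have hfo : Orthonormal ℝ f := by
    rw [orthonormal_iff_ite]
    intro i j
    rw [hf, inner_smul_left, inner_smul_right, hvc]
    split_ifs with h
    · subst h
      have : √(c i) ^ 2 = c i := Real.sq_sqrt (hcpos i).le
      have h2 : √(c i) ≠ 0 := (Real.sqrt_pos.2 (hcpos i)).ne'
      simp only [conj_trivial]
      field_simp
      exact this.symm
    · simp
  have hm : MeasurableSet {g : EuclideanSpace ℝ κ | (fun j => inner ℝ g (R (z j))) ∈ C} :=
    (show Measurable fun g : EuclideanSpace ℝ κ => fun j => inner ℝ g (R (z j)) by fun_prop) hC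
  have hsm : MeasurableSet {y : Fin r → ℝ | (fun i => √(c i) * y i) ∈ K} :=
    (show Measurable fun y : Fin r → ℝ => fun i => √(c i) * y i by fun_prop) hKm
  rw [measureReal_def, measureReal_def, ← map_inner_orthonormal_pi_gaussianReal hfo,
    Measure.map_apply (by fun_prop) hsm, ← map_pi_eq_stdGaussian,
    Measure.map_apply (by fun_prop) hm]
  congr 2
  ext g
  simp only [Set.mem_preimage, hK, hL]
  change _ ∈ C ↔ _ ∈ C
  congr! 1
  funext j
  conv_rhs => rw [hz j]
  rw [map_sum, inner_sum]
  refine Finset.sum_congr rfl fun l _ => ?_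
  have h2 : √(c l) ≠ 0 := (Real.sqrt_pos.2 (hcpos l)).ne'
  have h3 : inner ℝ (f l) (WithLp.toLp 2 g) =
      (√(c l))⁻¹ * inner ℝ (WithLp.toLp 2 g) (R (v l)) := by
    rw [hf, inner_smul_left, real_inner_comm (WithLp.toLp 2 g)]
    simp
  rw [map_smul, inner_smul_right]
  change inner ℝ (v l) (z j) * (√(c l) * inner ℝ (f l) (WithLp.toLp 2 g)) = _
  rw [h3]
  field_simp

/-! ### Normal cones at the vertices -/

section Polytope

variable {d n : ℕ} {X : Matrix (Fin d) (Fin n) ℝ} {I : Finset (Fin n)}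

theorem mem_normalCone_polytope_iff {x w : EuclideanSpace ℝ (Fin d)} :
    w ∈ normalCone (polytope X) x ↔ ∀ j, inner ℝ w (column X j - x) ≤ 0 := by
  constructor
  · exact fun h j => h _ (subset_convexHull ℝ _ ⟨j, rfl⟩)
  · intro h y hy
    have hconv : Convex ℝ {y : EuclideanSpace ℝ (Fin d) | inner ℝ w (y - x) ≤ 0} := by
      have : {y : EuclideanSpace ℝ (Fin d) | inner ℝ w (y - x) ≤ 0} =
          {y | innerSL ℝ w y ≤ inner ℝ w x} := by
        ext y; simp [inner_sub_right]
      rw [this]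
      exact convex_halfSpace_le (innerSL ℝ w).isBoundedLinearMap.toIsLinearMap _
    refine convexHull_min ?_ hconv hy
    rintro _ ⟨j, rfl⟩
    exact h j

theorem measurableSet_normalCone_polytope (x : EuclideanSpace ℝ (Fin d)) :
    MeasurableSet (normalCone (polytope X) x) := by
  have : normalCone (polytope X) x = ⋂ j, {w | inner ℝ w (column X j - x) ≤ 0} := by
    ext w; simp [mem_normalCone_polytope_iff]
  rw [this]
  exact MeasurableSet.iInter fun j => measurableSet_le (by fun_prop) (by fun_prop)

theorem smul_mem_normalCone_iff (C : Set (EuclideanSpace ℝ (Fin d)))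
    (x : EuclideanSpace ℝ (Fin d)) {c : ℝ} (hc : 0 < c) (w : EuclideanSpace ℝ (Fin d)) :
    c • w ∈ normalCone C x ↔ w ∈ normalCone C x := by
  simp only [normalCone, Set.mem_ofPred_eq, inner_smul_left, conj_trivial]
  exact forall₂_congr fun y _ => by
    constructor
    · intro h; by_contra! h'; nlinarith [mul_pos hc h']
    · intro h; nlinarith

/-- A linear functional that attains its maximum over the polytope only at a given vertex. -/
theorem IsExtremeIndexSet.exists_separating (hI : IsExtremeIndexSet X I) {i : Fin n} (hi : i ∈ I) :
    ∃ w : EuclideanSpace ℝ (Fin d), ∀ j, column X j ≠ column X i →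
      inner ℝ w (column X j - column X i) < 0 := by
  have hext : column X i ∈ (convexHull ℝ (Set.range (column X))).extremePoints ℝ := hI.1 hi
  have hnot := (
    Convex.mem_extremePoints_iff_mem_sdiff_convexHull_sdiff (convex_convexHull ℝ _)).1 hext
  -- Points are removed rather than the index `i`, since columns may repeat. The hull of the
  -- finitely many other points is compact and misses the vertex, so separation is strict.
  set A := Set.range (column X) \ {column X i} with hA
  have hAsub : convexHull ℝ A ⊆ convexHull ℝ (convexHull ℝ (Set.range (column X)) \ {column X i}) :=
    convexHull_mono (Set.sdiff_subset_sdiff_left (subset_convexHull ℝ _))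
  have hnotA : column X i ∉ convexHull ℝ A := fun h => hnot.2 (hAsub h)
  have hfin : A.Finite := (Set.finite_range _).subset Set.sdiff_subset
  obtain ⟨f, u, hfu, hux⟩ := geometric_hahn_banach_closed_point (convex_convexHull ℝ A)
    (hfin.isCompact_convexHull ℝ).isClosed hnotA
  refine ⟨(InnerProductSpace.toDual ℝ _).symm f, fun j hj => ?_⟩
  rw [InnerProductSpace.toDual_symm_apply, map_sub]
  linarith [hfu (column X j) (subset_convexHull ℝ A ⟨⟨j, rfl⟩, hj⟩)]

theorem stdGaussian_pos_of_isOpen {U : Set (EuclideanSpace ℝ (Fin d))} (hU : IsOpen U)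
    (hne : U.Nonempty) : 0 < stdGaussian (EuclideanSpace ℝ (Fin d)) U := by
  rw [stdGaussian_apply hU.measurableSet, setLIntegral_pos_iff (by fun_prop)]
  have : Function.support (fun w : EuclideanSpace ℝ (Fin d) =>
      ENNReal.ofReal ((√(2 * Real.pi))⁻¹ ^ d * Real.exp (-‖w‖ ^ 2 / 2))) = Set.univ := by
    ext w
    simp only [Function.mem_support, Set.mem_univ, iff_true]
    exact (ENNReal.ofReal_pos.2 (by positivity)).ne'
  rw [this, Set.univ_inter]
  exact hU.measure_pos _ hne

theorem stdGaussian_inner_eq_zero {z : EuclideanSpace ℝ (Fin d)} (hz : z ≠ 0) :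
    stdGaussian (EuclideanSpace ℝ (Fin d)) {w | inner ℝ w z = 0} = 0 := by
  have hm : MeasurableSet {w : EuclideanSpace ℝ (Fin d) | inner ℝ w z = 0} :=
    measurableSet_eq_fun (by fun_prop) (by fun_prop)
  rw [stdGaussian_apply hm]
  refine setLIntegral_measure_zero _ _ ?_
  have : {w : EuclideanSpace ℝ (Fin d) | inner ℝ w z = 0} =
      (LinearMap.ker (innerₛₗ ℝ z) : Set (EuclideanSpace ℝ (Fin d))) := by
    ext w; simp [real_inner_comm]
  rw [this]
  refine Measure.addHaar_submodule _ _ fun h => ?_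
  have : z ∈ LinearMap.ker (innerₛₗ ℝ z) := by rw [h]; trivial
  simp at this
  exact hz this

/-- The strictly separating functionals form a nonempty open subset of the normal cone. -/
theorem IsExtremeIndexSet.stdGaussian_normalCone_pos (hI : IsExtremeIndexSet X I) {i : Fin n}
    (hi : i ∈ I) :
    0 < (stdGaussian (EuclideanSpace ℝ (Fin d))).real (normalCone (polytope X) (column X i)) := by
  obtain ⟨w, hw⟩ := hI.exists_separating hi
  have hopen : IsOpen (⋂ j, {w : EuclideanSpace ℝ (Fin d) | column X j ≠ column X i →
      inner ℝ w (column X j - column X i) < 0}) := by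
    refine isOpen_iInter_of_finite fun j => ?_
    by_cases h : column X j = column X i
    · simp [h]
    · simp only [ne_eq, h, not_false_eq_true, forall_const]
      exact isOpen_lt (by fun_prop) (by fun_prop)
  refine ENNReal.toReal_pos ?_ (measure_ne_top _ _)
  refine ((stdGaussian_pos_of_isOpen hopen ⟨w, Set.mem_iInter.2 hw⟩).trans_le
    (measure_mono fun w' hw' => ?_)).ne'
  rw [mem_normalCone_polytope_iff]
  intro j
  by_cases h : column X j = column X i
  · simp [h]
  · exact (Set.mem_iInter.1 hw' j h).le

theorem stdGaussian_normalCone_inter {i j : Fin n} (hij : column X i ≠ column X j) :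
    stdGaussian (EuclideanSpace ℝ (Fin d))
      (normalCone (polytope X) (column X i) ∩ normalCone (polytope X) (column X j)) = 0 := by
  refine measure_mono_null ?_ (stdGaussian_inner_eq_zero (sub_ne_zero.2 hij))
  rintro w ⟨h1, h2⟩
  have := mem_normalCone_polytope_iff.1 h1 j
  have := mem_normalCone_polytope_iff.1 h2 i
  simp only [Set.mem_ofPred_eq, inner_sub_right] at *
  linarith

/-- The solid angles of the normal cones at the vertices add up to at most one. -/
theorem IsExtremeIndexSet.sum_stdGaussian_normalCone_le (hI : IsExtremeIndexSet X I) :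
    ∑ i ∈ I, (stdGaussian (EuclideanSpace ℝ (Fin d))).real
      (normalCone (polytope X) (column X i)) ≤ 1 := by
  rw [← measureReal_biUnion_finset₀ ?_ fun i _ =>
    (measurableSet_normalCone_polytope _).nullMeasurableSet]
  · exact measureReal_le_one
  · exact fun i hi j hj hij => stdGaussian_normalCone_inter fun h => hij (hI.2.1 hi hj h)

/-- The set of directions in which the functional attains its maximum or its minimum over the
polytope at `x`. -/
def extremalDirections (X : Matrix (Fin d) (Fin n) ℝ) (x : EuclideanSpace ℝ (Fin d)) :
    Set (EuclideanSpace ℝ (Fin d)) :=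
  {w | (∀ j, inner ℝ w (column X j - x) ≤ 0) ∨ ∀ j, 0 ≤ inner ℝ w (column X j - x)}

/-- Source of the factor `2` in `1 - 2ω`: the set is the normal cone together with its negative, and
a direction in both is orthogonal to `column X j - column X i`. The second, distinct column makes
that overlap null. -/
theorem stdGaussian_extremalDirections {i j : Fin n} (hij : column X i ≠ column X j) :
    (stdGaussian (EuclideanSpace ℝ (Fin d))).real (extremalDirections X (column X i)) =
      2 * (stdGaussian (EuclideanSpace ℝ (Fin d))).real
        (normalCone (polytope X) (column X i)) := by
  set N := normalCone (polytope X) (column X i) with hN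
  have hNm : MeasurableSet N := measurableSet_normalCone_polytope _
  have hunion : extremalDirections X (column X i) = N ∪ (fun w => -w) ⁻¹' N := by
    ext w
    simp only [extremalDirections, hN, Set.mem_union, Set.mem_preimage, Set.mem_ofPred_eq,
      mem_normalCone_polytope_iff, inner_neg_left, Left.neg_nonpos_iff]
  have hneg : (stdGaussian (EuclideanSpace ℝ (Fin d))).real ((fun w => -w) ⁻¹' N) =
      (stdGaussian (EuclideanSpace ℝ (Fin d))).real N := by
    have := stdGaussian_map (LinearIsometryEquiv.neg ℝ (E := EuclideanSpace ℝ (Fin d)))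
    rw [measureReal_def, measureReal_def]
    conv_rhs => rw [← this, Measure.map_apply (by fun_prop) hNm]
    rfl
  have hdisj : AEDisjoint (stdGaussian (EuclideanSpace ℝ (Fin d))) N ((fun w => -w) ⁻¹' N) := by
    refine measure_mono_null ?_ (stdGaussian_inner_eq_zero (sub_ne_zero.2 hij.symm))
    rintro w ⟨h1, h2⟩
    have h3 := mem_normalCone_polytope_iff.1 h1 j
    have h4 := mem_normalCone_polytope_iff.1 h2 j
    rw [inner_neg_left] at h4
    simp only [Set.mem_ofPred_eq]
    linarith
  rw [hunion, measureReal_union₀ (hNm.preimage measurable_neg).nullMeasurableSet hdisj, hneg]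
  ring

/-- A polytope in dimension at most one has at most two vertices. -/
theorem IsExtremeIndexSet.two_le_dim (hI : IsExtremeIndexSet X I) (hcard : 3 ≤ I.card) :
    2 ≤ d := by
  by_contra! hd
  obtain ⟨i, hi, j, hj, k, hk, hij, hik, hjk⟩ := Finset.two_lt_card.1 hcard
  have hne : ∀ {a b}, a ∈ I → b ∈ I → a ≠ b → column X a ≠ column X b := fun ha hb hab h =>
    hab (hI.2.1 ha hb h)
  rcases Nat.le_one_iff_eq_zero_or_eq_one.1 (Nat.lt_succ_iff.1 hd) with rfl | rfl
  · exact hne hi hj hij (Subsingleton.elim _ _)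
  · have hprod : ∀ {a b c}, a ∈ I → b ∈ I → c ∈ I → a ≠ b → a ≠ c →
        0 < (X 0 b - X 0 a) * (X 0 c - X 0 a) := by
      intro a b c ha hb hc hab hac
      obtain ⟨w, hw⟩ := hI.exists_separating ha
      have h1 := hw b (hne hb ha hab.symm)
      have h2 := hw c (hne hc ha hac.symm)
      simp only [column, PiLp.inner_apply, Fin.sum_univ_one, PiLp.sub_apply,
        RCLike.inner_apply, conj_trivial] at h1 h2
      have h3 := mul_pos_of_neg_of_neg h1 h2
      by_contra! h4
      nlinarith [mul_nonneg (sq_nonneg (w 0)) (neg_nonneg.2 h4)]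
    have h1 := hprod hi hj hk hij hik
    have h2 := hprod hj hi hk hij.symm hjk
    have h3 := hprod hk hi hj hik.symm hjk.symm
    -- On a line, each of the three vertices would have the other two on one side, which fails for
    -- the middle one: the product of the last two quantities is minus the first times a square.
    nlinarith [mul_pos h2 h3, mul_nonneg h1.le (sq_nonneg (X 0 j - X 0 k))]

end Polytope

/-! ### Scalar inequalities for the failure probability -/

/-- Put `l = log (1/(1-q))`. As `q ≤ 2/3`, one has `1 - p ≤ (1 - q)(1 + 3qt)`, and `q ≤ l` turns
this into `exp (-l (1 - 3t))`; then `m l ≥ L` is used. This needs `3t < 1`, and otherwise the right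
side is at least `1`. -/
theorem one_sub_pow_le_exp {p q t L : ℝ} {m : ℕ} (hq : 0 ≤ q) (hq1 : q ≤ 2 / 3)
    (ht : 0 ≤ t) (hp0 : 0 ≤ p) (hp1 : p ≤ 1) (hp : q * (1 - t) ≤ p) (hL : 0 ≤ L)
    (hm : L ≤ m * Real.log (1 / (1 - q))) :
    (1 - p) ^ m ≤ Real.exp (-L) * Real.exp (3 * t * L) := by
  rw [← Real.exp_add]
  by_cases h3 : 1 ≤ 3 * t
  · calc (1 - p) ^ m ≤ 1 := pow_le_one₀ (by linarith) (by linarith)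
      _ ≤ _ := Real.one_le_exp (by nlinarith)
  · push Not at h3
    have hq' : 0 < 1 - q := by linarith
    set l := Real.log (1 / (1 - q)) with hl
    have hexp : 1 - q = Real.exp (-l) := by
      rw [hl, one_div, Real.log_inv, neg_neg, Real.exp_log hq']
    have hql : q ≤ l := by
      have := Real.log_le_sub_one_of_pos hq'
      rw [hl, one_div, Real.log_inv]
      linarith
    have h1 : 1 - p ≤ (1 - q) * (1 + 3 * q * t) := by
      nlinarith [mul_nonneg hq ht, mul_nonneg (mul_nonneg hq ht) (by linarith : 0 ≤ 2 - 3 * q)]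
    have h2 : 1 + 3 * q * t ≤ Real.exp (3 * t * l) := by
      have := Real.add_one_le_exp (3 * t * l)
      nlinarith
    have h3' : 1 - p ≤ Real.exp (-(l * (1 - 3 * t))) := by
      calc 1 - p ≤ (1 - q) * (1 + 3 * q * t) := h1
        _ ≤ Real.exp (-l) * Real.exp (3 * t * l) := by rw [hexp]; gcongr
        _ = _ := by rw [← Real.exp_add]; ring_nf
    calc (1 - p) ^ m ≤ Real.exp (-(l * (1 - 3 * t))) ^ m :=
          pow_le_pow_left₀ (by linarith) h3' m
      _ = Real.exp (-(m * l * (1 - 3 * t))) := by rw [← Real.exp_nat_mul]; ring_nf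
      _ ≤ _ := Real.exp_le_exp.2 (by nlinarith)

/-- Trades an exponential for a square, which can be averaged with a second moment alone. For `y ≥
l/2` the quadratic term exceeds `1`; for `y ≤ 2/5` one has `e^y ≤ 3/2`; in between, `A ≤ e^(-l/2) ≤
8/l²`, and `50 y² ≥ 8`. -/
theorem le_add_sq_of_le_mul_exp {A δ y : ℝ} (hδ : 0 < δ) (hδ1 : δ < 1) (hy : 0 ≤ y)
    (h1 : A ≤ 1) (h2 : A ≤ δ * Real.exp y) :
    A ≤ 3 / 2 * δ + 50 * y ^ 2 / Real.log (1 / δ) ^ 2 := by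
  set l := Real.log (1 / δ) with hl
  have hlpos : 0 < l := Real.log_pos (by rw [lt_div_iff₀ hδ]; linarith)
  have hδl : δ = Real.exp (-l) := by
    rw [hl, one_div, Real.log_inv, neg_neg, Real.exp_log hδ]
  by_cases hyl : l / 2 ≤ y
  · have : 1 ≤ 50 * y ^ 2 / l ^ 2 := by
      rw [le_div_iff₀ (by positivity)]
      nlinarith
    linarith
  push Not at hyl
  by_cases hy4 : y ≤ 2 / 5
  · have : Real.exp y ≤ 3 / 2 := by
      rw [← Real.le_log_iff_exp_le (by norm_num)]
      have h4 : (2 : ℝ) / 5 * 5 ≤ 5 * Real.log (3 / 2) := by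
        have : (5 : ℝ) * Real.log (3 / 2) = Real.log ((3 / 2) ^ 5) := by
          rw [Real.log_pow]; norm_num
        rw [this, Real.le_log_iff_exp_le (by norm_num)]
        have h5 := Real.exp_one_lt_d9
        have h6 : Real.exp (2 / 5 * 5) = Real.exp 1 * Real.exp 1 := by
          rw [← Real.exp_add]; norm_num
        rw [h6]
        nlinarith [Real.exp_pos 1]
      linarith
    have h5 : 0 ≤ 50 * y ^ 2 / l ^ 2 := by positivity
    nlinarith
  · push Not at hy4
    have h3 : A ≤ Real.exp (-(l / 2)) := by
      refine h2.trans ?_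
      rw [hδl, ← Real.exp_add]
      exact Real.exp_le_exp.2 (by linarith)
    have h4 : Real.exp (-(l / 2)) ≤ 8 / l ^ 2 := by
      rw [Real.exp_neg, inv_le_comm₀ (Real.exp_pos _) (by positivity), inv_div]
      have := Real.quadratic_le_exp_of_nonneg (show 0 ≤ l / 2 by linarith)
      nlinarith
    have h5 : 8 / l ^ 2 ≤ 50 * y ^ 2 / l ^ 2 := by
      gcongr
      nlinarith
    linarith

theorem one_add_log_pow_four_le {x : ℝ} (hx : 1 ≤ x) :
    (1 + 2 * Real.log x) ^ 4 ≤ 83521 * √x := by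
  have hx0 : 0 < x := by linarith
  have h1 := Real.log_le_rpow_div hx0.le (show (0 : ℝ) < 1 / 8 by norm_num)
  have h2 : 1 ≤ x ^ (1 / 8 : ℝ) := Real.one_le_rpow hx (by norm_num)
  have h3 : 0 ≤ Real.log x := Real.log_nonneg hx
  have h4 : 1 + 2 * Real.log x ≤ 17 * x ^ (1 / 8 : ℝ) := by
    have : x ^ (1 / 8 : ℝ) / (1 / 8) = 8 * x ^ (1 / 8 : ℝ) := by ring
    linarith
  calc (1 + 2 * Real.log x) ^ 4 ≤ (17 * x ^ (1 / 8 : ℝ)) ^ 4 :=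
        pow_le_pow_left₀ (by linarith) h4 4
    _ = 83521 * √x := by
        rw [mul_pow, ← Real.rpow_natCast (x ^ (1 / 8 : ℝ)), ← Real.rpow_mul hx0.le,
          Real.sqrt_eq_rpow]
        norm_num

/-- The logarithmic factors in the error are dominated by the square root of `m`. -/
theorem log_factors_le {k m : ℕ} {δ q : ℝ} (hk : 3 ≤ k) (hδ : 0 < δ) (hδ1 : δ < 1 / 2)
    (hq : 0 < q) (hqk : q ≤ 2 / k) (hm : Real.log (k / δ) ≤ m * Real.log (1 / (1 - q))) :
    ((1 + Real.log (1 / q)) * Real.log (k / δ)) ^ 2 ≤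
      208803 * √m * Real.log (1 / δ) ^ 2 := by
  have hk' : (3 : ℝ) ≤ k := by exact_mod_cast hk
  have hk0 : (0 : ℝ) < k := by linarith
  have hq1 : q ≤ 2 / 3 := hqk.trans (by gcongr)
  have hl2 : 1 / 2 ≤ Real.log (1 / δ) := by
    have : Real.log 2 ≤ Real.log (1 / δ) :=
      Real.log_le_log (by norm_num) (by rw [le_div_iff₀ hδ]; linarith)
    linarith [Real.log_two_gt_d9]
  have hlogk : 1 / 2 ≤ Real.log k := by
    have : Real.log 2 ≤ Real.log k := Real.log_le_log (by norm_num) (by linarith)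
    linarith [Real.log_two_gt_d9]
  have hL : Real.log (k / δ) = Real.log k + Real.log (1 / δ) := by
    rw [div_eq_mul_one_div, Real.log_mul hk0.ne' (by positivity)]
  have hlq : Real.log (1 / (1 - q)) ≤ 3 * q := by
    have h0 : 0 < 1 - q := by linarith
    have := Real.log_le_sub_one_of_pos (show 0 < 1 / (1 - q) by positivity)
    refine this.trans ?_
    rw [sub_le_iff_le_add, div_le_iff₀ h0]
    nlinarith
  have hm0 : (0 : ℝ) ≤ m := Nat.cast_nonneg m
  -- `log (k/δ)` is at least `1/2 + 1/2`, so the row count forces `m ≥ 1/(3q)`. Hence `1/q` and,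
  -- through `q ≤ 2/k`, also `k` are at most `6m`.
  have h3qm : 1 ≤ 3 * q * m := by
    have : (m : ℝ) * Real.log (1 / (1 - q)) ≤ m * (3 * q) := by gcongr
    linarith
  have h1q : 1 / q ≤ 6 * m := by
    rw [div_le_iff₀ hq]; linarith
  have hk6 : (k : ℝ) ≤ 6 * m := by
    have h4 : q * k ≤ 2 := by rwa [le_div_iff₀ hk0] at hqk
    have h5 : k ≤ 3 * q * m * k := by nlinarith
    have h6 : 3 * q * m * k ≤ 6 * m := by nlinarith
    linarith
  have hlog1q : Real.log (1 / q) ≤ Real.log (6 * m) := Real.log_le_log (by positivity) h1q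
  have hlogk6 : Real.log k ≤ Real.log (6 * m) := Real.log_le_log hk0 hk6
  have hlog0 : 0 ≤ Real.log (1 / q) := Real.log_nonneg (by rw [le_div_iff₀ hq]; linarith)
  set M := Real.log (6 * m) with hM
  set l := Real.log (1 / δ) with hl
  have hLl : Real.log (k / δ) ≤ (1 + 2 * M) * l := by rw [hL]; nlinarith
  have hL0 : 0 ≤ Real.log (k / δ) := by rw [hL]; linarith
  have hprod : (1 + Real.log (1 / q)) * Real.log (k / δ) ≤ (1 + 2 * M) ^ 2 * l := by
    calc _ ≤ (1 + 2 * M) * ((1 + 2 * M) * l) := by gcongr <;> linarith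
      _ = _ := by ring
  have h6m : 1 ≤ 6 * (m : ℝ) := by linarith
  have h83 := one_add_log_pow_four_le h6m
  have hsq6 : √(6 * (m : ℝ)) ≤ 2.5 * √m := by
    rw [Real.sqrt_mul (by norm_num)]
    have : √(6 : ℝ) ≤ 2.5 := by
      rw [Real.sqrt_le_left (by norm_num)]; norm_num
    gcongr
  calc _ ≤ ((1 + 2 * M) ^ 2 * l) ^ 2 := pow_le_pow_left₀ (by positivity) hprod 2
    _ = (1 + 2 * M) ^ 4 * l ^ 2 := by ring
    _ ≤ (208803 * √m) * l ^ 2 := by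
        refine mul_le_mul_of_nonneg_right ?_ (sq_nonneg _)
        have := Real.sqrt_nonneg (m : ℝ)
        rw [hM]
        linarith

/-! ### The algorithm with a fixed sketch, and averaging over sketches -/

section Algorithm

variable {d n m B : ℕ} {X : Matrix (Fin d) (Fin n) ℝ} {I : Finset (Fin n)}

/-- The CountSketch matrix as a linear map. -/
noncomputable def sketchMap {B d : ℕ} (s : Fin d → Fin B × Bool) :
    EuclideanSpace ℝ (Fin d) →ₗ[ℝ] EuclideanSpace ℝ (Fin B) where
  toFun w := WithLp.toLp 2 (sketch s w)
  map_add' x y := by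
    ext b
    simp [sketch, mul_add, Finset.sum_add_distrib]
  map_smul' c x := by
    ext b
    simp only [sketch, PiLp.smul_apply, smul_eq_mul, RingHom.id_apply, Finset.mul_sum]
    exact Finset.sum_congr rfl fun j _ => by ring

theorem transform_mul_apply (ω : Sample m B d) (r : Fin m) (j : Fin n) :
    (transform ω * X) r j =
      inner ℝ (WithLp.toLp 2 (ω.1 r) : EuclideanSpace ℝ (Fin B)) (sketchMap ω.2 (column X j)) := by
  rw [transform, Matrix.mul_assoc, Matrix.mul_apply, PiLp.inner_apply]
  refine Finset.sum_congr rfl fun b _ => ?_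
  simp only [RCLike.inner_apply, conj_trivial]
  rw [mul_comm]
  rfl

theorem transform_mul_apply' (ω : Sample m B d) (r : Fin m) (j : Fin n) :
    (transform ω * X) r j =
      inner ℝ (WithLp.toLp 2 (transform ω r) : EuclideanSpace ℝ (Fin d)) (column X j) := by
  rw [Matrix.mul_apply, PiLp.inner_apply]
  refine Finset.sum_congr rfl fun b _ => ?_
  simp only [RCLike.inner_apply, conj_trivial]
  rw [mul_comm]
  rfl

theorem mem_algorithmOutput_iff (ω : Sample m B d) (i : Fin n) :
    i ∈ algorithmOutput X ω ↔ ∃ r, (∀ l, (transform ω * X) r l ≤ (transform ω * X) r i) ∨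
      ∀ l, (transform ω * X) r i ≤ (transform ω * X) r l := by
  rw [exists_or]
  rfl

/-- The values of a Gaussian row that make column `i` extremal, for a fixed sketch. -/
def goodRows (X : Matrix (Fin d) (Fin n) ℝ) (s : Fin d → Fin B × Bool) (i : Fin n) :
    Set (EuclideanSpace ℝ (Fin B)) :=
  {g | (∀ j, inner ℝ g (sketchMap s (column X j - column X i)) ≤ 0) ∨
    ∀ j, 0 ≤ inner ℝ g (sketchMap s (column X j - column X i))}

theorem measurableSet_goodRows (s : Fin d → Fin B × Bool) (i : Fin n) :
    MeasurableSet (goodRows X s i) := by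
  have : goodRows X s i =
      (⋂ j, {g | inner ℝ g (sketchMap s (column X j - column X i)) ≤ 0}) ∪
        ⋂ j, {g | 0 ≤ inner ℝ g (sketchMap s (column X j - column X i))} := by
    ext g; simp [goodRows]
  rw [this]
  exact (MeasurableSet.iInter fun j => measurableSet_le (by fun_prop) (by fun_prop)).union
    (MeasurableSet.iInter fun j => measurableSet_le (by fun_prop) (by fun_prop))

theorem mem_algorithmOutput_iff_goodRows (ω : Sample m B d) (i : Fin n) :
    i ∈ algorithmOutput X ω ↔ ∃ r, WithLp.toLp 2 (ω.1 r) ∈ goodRows X ω.2 i := by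
  simp only [mem_algorithmOutput_iff, transform_mul_apply, goodRows, Set.mem_ofPred_eq, map_sub,
    inner_sub_right, sub_nonpos, sub_nonneg]

theorem measurable_transform_mul (r : Fin m) (j : Fin n) :
    Measurable fun ω : Sample m B d => (transform ω * X) r j := by
  have h : ∀ ω : Sample m B d, (transform ω * X) r j =
      ∑ b, ω.1 r b * sketch ω.2 (column X j) b := fun ω => by
    rw [transform_mul_apply, PiLp.inner_apply]
    refine Finset.sum_congr rfl fun b _ => ?_
    simp only [RCLike.inner_apply, conj_trivial]
    rw [mul_comm]
    rfl
  simp_rw [h]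
  refine Finset.measurable_sum _ fun b _ => Measurable.mul (by fun_prop) ?_
  exact (measurable_of_finite fun s : Fin d → Fin B × Bool => sketch s (column X j) b).comp
    measurable_snd

theorem measurableSet_subset_algorithmOutput :
    MeasurableSet {ω : Sample m B d | (I : Set (Fin n)) ⊆ algorithmOutput X ω} := by
  have : {ω : Sample m B d | (I : Set (Fin n)) ⊆ algorithmOutput X ω} =
      ⋂ i ∈ I, ⋃ r, ((⋂ l, {ω | (transform ω * X) r l ≤ (transform ω * X) r i}) ∪
        ⋂ l, {ω | (transform ω * X) r i ≤ (transform ω * X) r l}) := by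
    ext ω
    simp [Set.subset_def, mem_algorithmOutput_iff]
  rw [this]
  refine Finset.measurableSet_biInter _ fun i _ => MeasurableSet.iUnion fun r => ?_
  exact (MeasurableSet.iInter fun l => measurableSet_le (measurable_transform_mul r l)
    (measurable_transform_mul r i)).union (MeasurableSet.iInter fun l =>
      measurableSet_le (measurable_transform_mul r i) (measurable_transform_mul r l))

theorem sampleLaw_real_apply [NeZero B] {A : Set (Sample m B d)} (hA : MeasurableSet A) :
    (sampleLaw m B d).real A = ∑ s : Fin d → Fin B × Bool, ((2 * B : ℝ) ^ d)⁻¹ *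
      (Measure.pi fun _ : Fin m => Measure.pi fun _ : Fin B => gaussianReal 0 1).real
        {G | (G, s) ∈ A} := by
  rw [measureReal_def, sampleLaw, Measure.prod_apply_symm hA, lintegral_fintype,
    ENNReal.toReal_sum fun s _ => ENNReal.mul_ne_top (measure_ne_top _ _) (measure_ne_top _ _)]
  refine Finset.sum_congr rfl fun s _ => ?_
  rw [ENNReal.toReal_mul, ← measureReal_def, ← measureReal_def, sketchLaw_singleton, mul_comm]
  rfl

/-- For a fixed sketch, the rows of the transform are independent. -/
theorem gaussianRows_real_notMem_le (s : Fin d → Fin B × Bool) :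
    (Measure.pi fun _ : Fin m => Measure.pi fun _ : Fin B => gaussianReal 0 1).real
      {G | (G, s) ∈ {ω : Sample m B d | (I : Set (Fin n)) ⊆ algorithmOutput X ω}ᶜ} ≤
      ∑ i ∈ I, (1 - (stdGaussian (EuclideanSpace ℝ (Fin B))).real (goodRows X s i)) ^ m := by
  have hset : {G : Fin m → Fin B → ℝ |
      (G, s) ∈ {ω : Sample m B d | (I : Set (Fin n)) ⊆ algorithmOutput X ω}ᶜ} ⊆
      ⋃ i ∈ I, Set.univ.pi fun _ => WithLp.toLp 2 ⁻¹' (goodRows X s i)ᶜ := by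
    intro G hG
    simp only [Set.mem_compl_iff, Set.mem_ofPred_eq, Set.not_subset] at hG
    obtain ⟨i, hi, hG⟩ := hG
    rw [mem_algorithmOutput_iff_goodRows, not_exists] at hG
    exact Set.mem_biUnion hi fun r _ => hG r
  refine (measureReal_mono hset (measure_ne_top _ _)).trans
    ((measureReal_biUnion_finset_le _ _).trans (Finset.sum_le_sum fun i _ => le_of_eq ?_))
  rw [measureReal_def, Measure.pi_pi, Finset.prod_const, Finset.card_univ, Fintype.card_fin,
    ENNReal.toReal_pow, ← Measure.map_apply (by fun_prop) (measurableSet_goodRows s i).compl,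
    map_pi_eq_stdGaussian, ← measureReal_def,
    probReal_compl_eq_one_sub (measurableSet_goodRows s i)]

/-- The squared Frobenius distance between the Gram matrices before and after the sketch of an
orthonormal basis of a subspace. -/
noncomputable def gramError {r : ℕ} (u : Fin r → EuclideanSpace ℝ (Fin d))
    (s : Fin d → Fin B × Bool) : ℝ :=
  ∑ j, ∑ l, (inner ℝ (sketchMap s (u j)) (sketchMap s (u l)) - inner ℝ (u j) (u l)) ^ 2

theorem gramError_nonneg {r : ℕ} (u : Fin r → EuclideanSpace ℝ (Fin d))
    (s : Fin d → Fin B × Bool) : 0 ≤ gramError u s :=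
  Finset.sum_nonneg fun _ _ => Finset.sum_nonneg fun _ _ => sq_nonneg _

/-- Each of the `r ^ 2` Gram entries has mean square error at most `2 / B`; this yields the `n ^ 2`
in the bound on `B`. -/
theorem sum_gramError_le {r : ℕ} (hB : 1 ≤ B) {u : Fin r → EuclideanSpace ℝ (Fin d)}
    (hu : ∀ j, ‖u j‖ = 1) :
    ∑ s : Fin d → Fin B × Bool, ((2 * B : ℝ) ^ d)⁻¹ * gramError u s ≤ 2 * (r : ℝ) ^ 2 / B := by
  have hB0 : (0 : ℝ) < B := by exact_mod_cast hB
  have hpair : ∀ j l, ∑ s : Fin d → Fin B × Bool,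
      (inner ℝ (sketchMap s (u j)) (sketchMap s (u l)) - inner ℝ (u j) (u l)) ^ 2 ≤
        (2 * B : ℝ) ^ d * (2 / B) := by
    intro j l
    have h := sum_sketch_inner_sub_sq_le hB (u j) (u l)
    rw [← EuclideanSpace.real_norm_sq_eq, ← EuclideanSpace.real_norm_sq_eq, hu, hu] at h
    simp only [one_pow, mul_one] at h
    refine le_trans (le_of_eq (Finset.sum_congr rfl fun s _ => ?_)) h
    simp only [PiLp.inner_apply, RCLike.inner_apply, conj_trivial]
    congr 2
    · exact Finset.sum_congr rfl fun b _ => mul_comm _ _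
    · exact Finset.sum_congr rfl fun b _ => mul_comm _ _
  rw [← Finset.mul_sum]
  have h1 : ∑ s : Fin d → Fin B × Bool, gramError u s ≤
      (2 * B : ℝ) ^ d * (2 * (r : ℝ) ^ 2 / B) := by
    calc ∑ s : Fin d → Fin B × Bool, gramError u s = ∑ j, ∑ l, ∑ s : Fin d → Fin B × Bool,
          (inner ℝ (sketchMap s (u j)) (sketchMap s (u l)) - inner ℝ (u j) (u l)) ^ 2 := by
          simp only [gramError]
          rw [Finset.sum_comm]
          exact Finset.sum_congr rfl fun j _ => Finset.sum_comm
      _ ≤ ∑ _j : Fin r, ∑ _l : Fin r, (2 * B : ℝ) ^ d * (2 / B) :=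
          Finset.sum_le_sum fun j _ => Finset.sum_le_sum fun l _ => hpair j l
      _ = _ := by simp; ring
  rw [inv_mul_le_iff₀ (by positivity)]
  exact h1

/-- The columns of `X` span a subspace of dimension at most `n`; every sketch with small Gram error
on it makes column `i` extremal with almost the same probability as a Gaussian row. -/
theorem exists_gramError_bound (X : Matrix (Fin d) (Fin n) ℝ) :
    ∃ (r : ℕ) (u : Fin r → EuclideanSpace ℝ (Fin d)), r ≤ n ∧ (∀ j, ‖u j‖ = 1) ∧
      ∀ (B : ℕ) (s : Fin d → Fin B × Bool) (i : Fin n),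
        (stdGaussian (EuclideanSpace ℝ (Fin d))).real (extremalDirections X (column X i)) *
          (1 - 8 * √(gramError u s) * (1 + Real.log (1 / (stdGaussian
            (EuclideanSpace ℝ (Fin d))).real (extremalDirections X (column X i))))) ≤
          (stdGaussian (EuclideanSpace ℝ (Fin B))).real (goodRows X s i) := by
  set V := Submodule.span ℝ (Set.range (column X)) with hV
  have hcol : ∀ j, column X j ∈ V := fun j => Submodule.subset_span ⟨j, rfl⟩
  set u := stdOrthonormalBasis ℝ V
  refine ⟨_, fun j => u j, ?_, fun j => u.norm_eq_one j, fun B s i => ?_⟩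
  · exact (finrank_range_le_card (R := ℝ) (column X)).trans_eq (Fintype.card_fin n)
  · have hC : MeasurableSet {y : Fin n → ℝ | (∀ j, y j ≤ 0) ∨ ∀ j, 0 ≤ y j} := by
      have : {y : Fin n → ℝ | (∀ j, y j ≤ 0) ∨ ∀ j, 0 ≤ y j} =
          (⋂ j, {y | y j ≤ 0}) ∪ ⋂ j, {y | 0 ≤ y j} := by
        ext y; simp
      rw [this]
      exact (MeasurableSet.iInter fun j => measurableSet_le (by fun_prop) (by fun_prop)).union
        (MeasurableSet.iInter fun j => measurableSet_le (by fun_prop) (by fun_prop))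
    exact stdGaussian_map_ge u (sketchMap s ∘ₗ V.subtype)
      (fun j => ⟨column X j - column X i, V.sub_mem (hcol j) (hcol i)⟩) hC

/-- With at most two vertices every row finds all of them. -/
theorem subset_algorithmOutput_of_card_le_two (hI : IsExtremeIndexSet X I) (hcard : I.card ≤ 2)
    (hm : 1 ≤ m) (ω : Sample m B d) : (I : Set (Fin n)) ⊆ algorithmOutput X ω := by
  intro i hi
  rw [mem_algorithmOutput_iff]
  refine ⟨⟨0, hm⟩, ?_⟩
  set w : EuclideanSpace ℝ (Fin d) := WithLp.toLp 2 (transform ω ⟨0, hm⟩)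
  simp only [transform_mul_apply']
  -- For a single vertex `b = i`, and the segment below degenerates to a point.
  obtain ⟨b, hb⟩ : ∃ b, I ⊆ {i, b} := by
    by_cases h : I ⊆ {i}
    · exact ⟨i, by simpa using h⟩
    · obtain ⟨b, hbI, hbi⟩ := Finset.not_subset.1 h
      refine ⟨b, fun c hc => ?_⟩
      by_contra hcn
      simp only [Finset.mem_insert, Finset.mem_singleton, not_or] at hcn hbi
      have := Finset.two_lt_card.2 ⟨i, hi, b, hbI, c, hc, Ne.symm hbi, Ne.symm hcn.1, Ne.symm hcn.2⟩
      omega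
  -- By Krein–Milman all columns lie on the segment from `column X i` to `column X b`, where a
  -- linear functional is extremal at either endpoint.
  have hcompact : IsCompact (polytope X) := (Set.finite_range _).isCompact_convexHull ℝ
  have hKM := closure_convexHull_extremePoints hcompact (convex_convexHull ℝ _)
  have hext : (polytope X).extremePoints ℝ ⊆ {column X i, column X b} := by
    rw [← hI.image_eq]
    rintro _ ⟨c, hc, rfl⟩
    have := hb hc
    simp only [Finset.mem_insert, Finset.mem_singleton] at this
    rcases this with rfl | rfl <;> simp
  have hseg : ∀ j, column X j ∈ segment ℝ (column X i) (column X b) := fun j => by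
    have h1 : column X j ∈ polytope X := subset_convexHull ℝ _ ⟨j, rfl⟩
    rw [← hKM] at h1
    have h2 := closure_mono (convexHull_mono (𝕜 := ℝ) hext) h1
    rwa [((Set.toFinite {column X i, column X b}).isCompact_convexHull ℝ).isClosed.closure_eq,
      convexHull_pair] at h2
  have hval : ∀ j, ∃ t : ℝ, 0 ≤ t ∧ inner ℝ w (column X j) =
      inner ℝ w (column X i) + t * inner ℝ w (column X b - column X i) := fun j => by
    obtain ⟨t, ht, hj⟩ := (segment_eq_image' ℝ (column X i) (column X b)) ▸ hseg j
    refine ⟨t, ht.1, ?_⟩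
    rw [← hj, inner_add_right, inner_smul_right]
  rcases le_total (inner ℝ w (column X b - column X i)) 0 with h | h
  · left
    intro j
    obtain ⟨t, ht, hj⟩ := hval j
    rw [hj]
    nlinarith
  · right
    intro j
    obtain ⟨t, ht, hj⟩ := hval j
    rw [hj]
    nlinarith

/-- The condition number in terms of the smallest solid angle `q / 2`. -/
theorem IsExtremeIndexSet.exists_conditionNumber_eq (hI : IsExtremeIndexSet X I)
    (hcard : 3 ≤ I.card) :
    ∃ q : ℝ, 0 < q ∧ q ≤ 2 / I.card ∧
      conditionNumber X I * I.card = 1 / Real.log (1 / (1 - q)) ∧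
      ∀ i ∈ I, q ≤ (stdGaussian (EuclideanSpace ℝ (Fin d))).real
        (extremalDirections X (column X i)) := by
  have hd : d ≠ 0 := by have := hI.two_le_dim hcard; omega
  have hne : I.Nonempty := Finset.card_pos.1 (by omega)
  have hc0 : (0 : ℝ) < I.card := by exact_mod_cast Finset.card_pos.2 hne
  set ω : Fin n → ℝ := fun i => (stdGaussian (EuclideanSpace ℝ (Fin d))).real
    (normalCone (polytope X) (column X i)) with hω
  have hsolid : ∀ i, solidAngle (normalCone (polytope X) (column X i)) = ω i := fun i =>
    solidAngle_eq_stdGaussian hd (measurableSet_normalCone_polytope _)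
      fun c hc w => smul_mem_normalCone_iff _ _ hc w
  obtain ⟨i₀, hi₀, hmin⟩ := I.exists_min_image ω hne
  have hsup : ⨆ i : I, (1 - 2 * solidAngle (normalCone (polytope X) (column X i))) =
      1 - 2 * ω i₀ := by
    have : Nonempty I := ⟨⟨i₀, hi₀⟩⟩
    refine le_antisymm (ciSup_le fun i => ?_) ?_
    · rw [hsolid]
      linarith [hmin i i.2]
    · refine le_ciSup_of_le (Set.finite_range _).bddAbove ⟨i₀, hi₀⟩ ?_
      rw [hsolid]
  -- The supremum of `1 - 2ω` is attained at the smallest angle, so `q` is twice that angle. The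
  -- angles sum to at most one, so the smallest is at most `1 / k`.
  refine ⟨2 * ω i₀, by linarith [hI.stdGaussian_normalCone_pos hi₀], ?_, ?_, fun i hi => ?_⟩
  · rw [le_div_iff₀ hc0]
    have h1 : I.card • ω i₀ ≤ ∑ i ∈ I, ω i := Finset.card_nsmul_le_sum _ _ _ hmin
    have h2 := hI.sum_stdGaussian_normalCone_le
    rw [nsmul_eq_mul] at h1
    linarith
  · rw [conditionNumber, hsup]
    field_simp
  · obtain ⟨j, hj, hji⟩ := Finset.exists_mem_ne (show 1 < I.card by omega) i
    rw [stdGaussian_extremalDirections (j := j) fun h => hji (hI.2.1 hj hi h.symm)]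
    linarith [hmin i hi]

/-- The failure probability for at least three vertices. -/
theorem sampleLaw_compl_le {δ : ℝ} (hI : IsExtremeIndexSet X I) (hcard : 3 ≤ I.card)
    (hδ : 0 < δ) (hδ1 : δ < 1 / 2) (hB : 1 ≤ B)
    (hm : conditionNumber X I * I.card * Real.log (I.card / δ) ≤ m)
    (hBm : 1 / δ * 10 ^ 12 * Real.log d ^ 4 * (n : ℝ) ^ 2 * (m : ℝ) ^ (1 / 2 : ℝ) ≤ B) :
    (sampleLaw m B d).real
      {ω : Sample m B d | (I : Set (Fin n)) ⊆ algorithmOutput X ω}ᶜ ≤ 2 * δ := by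
  have : NeZero B := ⟨by omega⟩
  have hB0 : (0 : ℝ) < B := by exact_mod_cast hB
  have hk3 : (3 : ℝ) ≤ I.card := by exact_mod_cast hcard
  obtain ⟨q, hq0, hqk, hκ, hq⟩ := hI.exists_conditionNumber_eq hcard
  have hq1 : q ≤ 2 / 3 := hqk.trans (by gcongr)
  set k : ℕ := I.card with hk
  set L := Real.log (k / δ) with hL
  set l := Real.log (1 / δ) with hl
  have hlpos : 0 < l := Real.log_pos (by rw [lt_div_iff₀ hδ]; linarith)
  have hlogpos : 0 < Real.log (1 / (1 - q)) := Real.log_pos (by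
    rw [lt_div_iff₀ (by linarith)]; linarith)
  have hmL : L ≤ m * Real.log (1 / (1 - q)) := by
    rw [hκ, one_div_mul_eq_div, div_le_iff₀ hlogpos] at hm
    exact hm
  have hL0 : 0 ≤ L := Real.log_nonneg (by rw [le_div_iff₀ hδ]; linarith)
  have hexpL : Real.exp (-L) = δ / k := by
    rw [hL, Real.exp_neg, Real.exp_log (by positivity), inv_div]
  obtain ⟨r, u, hr, hu, hgram⟩ := exists_gramError_bound X
  set a := 1 + Real.log (1 / q) with ha
  have hlogq : 0 ≤ Real.log (1 / q) := Real.log_nonneg (by rw [le_div_iff₀ hq0]; linarith)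
  set P : (Fin d → Fin B × Bool) → ℝ := fun s =>
    (Measure.pi fun _ : Fin m => Measure.pi fun _ : Fin B => gaussianReal 0 1).real
      {G | (G, s) ∈ {ω : Sample m B d | (I : Set (Fin n)) ⊆ algorithmOutput X ω}ᶜ} with hP
  have hPs : ∀ s, P s ≤ 3 / 2 * δ + 28800 * (a * L) ^ 2 / l ^ 2 * gramError u s := by
    intro s
    -- Bounds the relative loss for all vertices at once, since `log (1/q_i) ≤ log (1/q)`.
    set t := 8 * √(gramError u s) * a with ht
    have ht0 : 0 ≤ t := by positivity
    have hsum : P s ≤ δ * Real.exp (3 * t * L) := by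
      refine (gaussianRows_real_notMem_le s).trans ?_
      have : ∀ i ∈ I, (1 - (stdGaussian (EuclideanSpace ℝ (Fin B))).real (goodRows X s i)) ^ m ≤
          δ / k * Real.exp (3 * t * L) := by
        intro i hi
        rw [← hexpL]
        refine one_sub_pow_le_exp hq0.le hq1 ht0 measureReal_nonneg measureReal_le_one ?_ hL0 hmL
        -- Replacing `q` by the larger `qi` needs `1 - t ≥ 0`; otherwise the bound is trivial.
        by_cases h1 : t ≤ 1
        · refine le_trans ?_ (hgram B s i)
          set qi := (stdGaussian (EuclideanSpace ℝ (Fin d))).real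
            (extremalDirections X (column X i)) with hqi
          have hqqi : q ≤ qi := hq i hi
          have hqi0 : 0 < qi := hq0.trans_le hqqi
          have hai : 8 * √(gramError u s) * (1 + Real.log (1 / qi)) ≤ t := by
            rw [ht, ha]
            gcongr
          calc q * (1 - t) ≤ qi * (1 - t) := by gcongr
            _ ≤ _ := by gcongr
        · refine le_trans ?_ measureReal_nonneg
          exact mul_nonpos_of_nonneg_of_nonpos hq0.le (by linarith)
      refine (Finset.sum_le_sum this).trans_eq ?_
      rw [Finset.sum_const, nsmul_eq_mul, ← hk]
      field_simp
    -- Here `y = 24 √(gramError u s) a L`, so the bound becomes linear in the Gram error, with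
    -- constant `28800 = 50 * 24 ^ 2`.
    have h := le_add_sq_of_le_mul_exp hδ (by linarith) (by positivity) measureReal_le_one hsum
    refine h.trans_eq ?_
    have hsq : √(gramError u s) ^ 2 = gramError u s := Real.sq_sqrt (gramError_nonneg u s)
    rw [← hl, ht, show (3 * (8 * √(gramError u s) * a) * L) ^ 2 =
      576 * (a * L) ^ 2 * √(gramError u s) ^ 2 by ring, hsq]
    ring
  have hw : ∑ _s : Fin d → Fin B × Bool, ((2 * B : ℝ) ^ d)⁻¹ = 1 := by
    rw [Finset.sum_const, nsmul_eq_mul, Finset.card_univ]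
    simp only [Fintype.card_fun, Fintype.card_prod, Fintype.card_fin, Fintype.card_bool]
    push_cast
    rw [mul_comm (B : ℝ)]
    exact mul_inv_cancel₀ (by positivity)
  rw [sampleLaw_real_apply measurableSet_subset_algorithmOutput.compl]
  calc ∑ s : Fin d → Fin B × Bool, ((2 * B : ℝ) ^ d)⁻¹ * P s
      ≤ ∑ s : Fin d → Fin B × Bool, ((2 * B : ℝ) ^ d)⁻¹ *
          (3 / 2 * δ + 28800 * (a * L) ^ 2 / l ^ 2 * gramError u s) :=
        Finset.sum_le_sum fun s _ => mul_le_mul_of_nonneg_left (hPs s) (by positivity)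
    _ = 3 / 2 * δ + 28800 * (a * L) ^ 2 / l ^ 2 *
          ∑ s : Fin d → Fin B × Bool, ((2 * B : ℝ) ^ d)⁻¹ * gramError u s := by
        simp_rw [mul_add]
        rw [Finset.sum_add_distrib, ← Finset.sum_mul, hw, one_mul, Finset.mul_sum]
        congr 1
        exact Finset.sum_congr rfl fun s _ => by ring
    _ ≤ 3 / 2 * δ + 28800 * (a * L) ^ 2 / l ^ 2 * (2 * (n : ℝ) ^ 2 / B) := by
        gcongr
        refine (sum_gramError_le hB hu).trans ?_
        gcongr
    _ ≤ 3 / 2 * δ + 28800 * (208803 * √m) * (2 * (n : ℝ) ^ 2 / B) := by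
        gcongr
        rw [mul_div_assoc]
        gcongr
        rw [div_le_iff₀ (by positivity)]
        exact log_factors_le hcard hδ hδ1 hq0 hqk hmL
    _ ≤ 2 * δ := by
        -- Three vertices force `d ≥ 2`. The factor `log d ^ 4` enters only through the lower bound
        -- `0.22`.
        have hd : (2 : ℝ) ≤ d := by exact_mod_cast hI.two_le_dim hcard
        have hlogd : (0.69 : ℝ) ≤ Real.log d := by
          have := Real.log_le_log (by norm_num) hd
          linarith [Real.log_two_gt_d9]
        have hlogd4 : (0.22 : ℝ) ≤ Real.log d ^ 4 := by
          refine le_trans ?_ (pow_le_pow_left₀ (by norm_num) hlogd 4)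
          norm_num
        rw [← Real.sqrt_eq_rpow] at hBm
        have hkey : 10 ^ 12 * 0.22 * ((n : ℝ) ^ 2 * √m) ≤ δ * B := by
          calc 10 ^ 12 * 0.22 * ((n : ℝ) ^ 2 * √m)
              ≤ 10 ^ 12 * Real.log d ^ 4 * ((n : ℝ) ^ 2 * √m) := by gcongr
            _ = δ * (1 / δ * 10 ^ 12 * Real.log d ^ 4 * (n : ℝ) ^ 2 * √m) := by field_simp
            _ ≤ δ * B := by gcongr
        have hx : 0 ≤ (n : ℝ) ^ 2 * √m := by positivity
        -- The constants multiply to about `1.2 * 10 ^ 10`, below `0.11 * 10 ^ 12`.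
        have : 28800 * (208803 * √m) * (2 * (n : ℝ) ^ 2 / B) ≤ δ / 2 := by
          rw [← mul_div_assoc, div_le_iff₀ hB0]
          linarith
        linarith

end Algorithm

end CountGauss

/-! ### Conclusion -/

theorem mainTheorem3 :
    ∃ C : ℝ, 1 < C ∧
      ∀ (d n k m B : ℕ) (X : Matrix (Fin d) (Fin n) ℝ) (I : Finset (Fin n)) (δ : ℝ),
        CountGauss.IsSeparable X k I →
        CountGauss.IsExtremeIndexSet X I →
        0 < δ →
        1 ≤ m →
        CountGauss.conditionNumber X I * k * Real.log (k / δ) ≤ m →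
        1 ≤ B →
        1 / δ * C * Real.log d ^ 4 * (n : ℝ) ^ 2 * (m : ℝ) ^ (1 / 2 : ℝ) ≤ B →
        ENNReal.ofReal (1 - 2 * δ) ≤
          CountGauss.sampleLaw m B d {ω | (I : Set (Fin n)) ⊆ CountGauss.algorithmOutput X ω} := by
  refine ⟨10 ^ 12, by norm_num, fun d n k m B X I δ hsep hI hδ hm hκ hB hBm => ?_⟩
  obtain ⟨rfl, -, -⟩ := hsep
  have : NeZero B := ⟨by omega⟩
  by_cases hcard : I.card ≤ 2
  · have : {ω : CountGauss.Sample m B d | (I : Set (Fin n)) ⊆ CountGauss.algorithmOutput X ω} =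
        Set.univ :=
      Set.eq_univ_of_forall (CountGauss.subset_algorithmOutput_of_card_le_two hI hcard hm)
    rw [this, measure_univ, ← ENNReal.ofReal_one]
    exact ENNReal.ofReal_le_ofReal (by linarith)
  by_cases hδ1 : 1 / 2 ≤ δ
  · rw [ENNReal.ofReal_of_nonpos (by linarith)]
    exact zero_le
  push Not at hδ1 hcard
  have h := CountGauss.sampleLaw_compl_le hI hcard hδ hδ1 hB hκ hBm
  rw [probReal_compl_eq_one_sub CountGauss.measurableSet_subset_algorithmOutput] at h
  exact ENNReal.ofReal_le_of_le_toReal (by rw [← measureReal_def]; linarith)
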